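/- **Setting.** There are $m\ge 1$ objects. A ranking is a permutation $\sigma$, where $\sigma(i)\in\{1,\dots,m\}$ is the rank of object $i$. Fix $n\ge 1$. For $r\in\{0,1,\dots,n\}^m$ put $$DCG(\sigma,r)=\sum_{i=1}^m\frac{2^{r(i)}-1}{\log_2(1+\sigma(i))},$$ which for binary relevance ($n=1$) is $\sum_i r(i)/\log_2(1+\sigma(i))$. An oblivious adversary fixes $r_1,\dots,r_T\in\{0,\dots,n\}^m$. In round $t$ the learner outputs a ranking $\sigma_t$, chosen from its internal randomness and the feedback of earlier rounds, and then observes only $r_t(\sigma_t^{-1}(1))$, the relevance of the object on top. The expected regret is $$\max_\sigma\sum_{t=1}^T DCG(\sigma,r_t)-\mathbb E\Big[\sum_{t=1}^T DCG(\sigma_t,r_t)\Big].$$ **Algorithm RTop-1F** (with $K\ge1$ blocks, parameter $\epsilon>0$, transformation $g$). Let $B=\lfloor T/K\rfloor\ge m$ and divide the first $KB$ rounds into $K$ consecutive blocks of length $B$. In each block, independently, draw $m$ distinct rounds $i_1,\dots,i_m$ uniformly at random without replacement. In round $i_j$ output any ranking with object $j$ on top and observe $r_{i_j}(j)$. In every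 other round $t$ draw $p_t$ uniformly from $[0,1/\epsilon]^m$ (independently of everything else) and output $\sigma_t\in\arg\min_\sigma\sum_i\sigma(i)\,(\hat s+p_t)(i)$, where $\hat s$ is the sum of the vectors $[g(r_{i_1}(1)),\dots,g(r_{i_m}(m))]$ over the blocks preceding the current one, and ties are broken arbitrarily. The fewer than $K$ rounds left over at the end are played in this second way, with $\hat s$ the sum over all blocks. **Theorem.** 1. *(Upper bound.)* There is an absolute constant $C$ such that for all $m,n\ge1$, all $T$, and all $r_1,\dots,r_T\in\{0,\dots,n\}^m$, RTop-1F with $g(v)=2^v-1$, $K=\lfloor m^{-1/3}T^{2/3}\rfloor$ and $\epsilon=\sqrt{\frac1{(2^n-1)^2mK}}$ has expected regret at most $C\,(2^n-1)\,m^{5/3}\,T^{2/3}$, provided that it can be run, i.e. $K\ge1$ and $\lfloor T/K\rfloor\ge m$; this is the case whenever $T\ge m^2$. 2. *(Binary relevance.)* In the same sense, for $r_t\in\{0,1\}^m$, RTop-1F on the untransformed relevances ($g(v)=v$) with the same $K$ and $\epsilon=\sqrt{\frac1{mK}}$ has expected regret at most $C\,m^{5/3}\,T^{2/3}$. 3.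 *(Failure of local observability.)* For all $m\ge3$ and $n\ge1$ the DCG game with top-1 feedback is not locally observable. Here $\ell_\sigma=(DCG(\sigma,r))_r\in\mathbb R^{N}$ with $N=(n+1)^m$. The cell $C_\sigma$ is the set of probability vectors $p$ with $\ell_\sigma\cdot p\ge\ell_{\sigma'}\cdot p$ for all $\sigma'$, and $\sigma$ is Pareto-optimal if $C_\sigma$ has dimension $N-1$. Distinct Pareto-optimal $\sigma,\sigma'$ are neighbors if $C_\sigma\cap C_{\sigma'}$ has dimension $N-2$, and $N^+_{\sigma,\sigma'}=\{\kappa: C_\sigma\cap C_{\sigma'}\subseteq C_\kappa\}$. The signal matrix $S_\kappa\in\{0,1\}^{(n+1)\times N}$ has entries $\mathbb 1(r(\kappa^{-1}(1))=v)$ for $v\in\{0,\dots,n\}$. Local observability means that $\ell_\sigma-\ell_{\sigma'}\in\sum_{\kappa\in N^+_{\sigma,\sigma'}}\mathrm{Col}(S_\kappa^\top)$ for all neighbors $\sigma,\sigma'$. 4. *(Lower bound.)* There is an absolute constant $c>0$ such that for all $m\ge3$, $n\ge1$, $T\ge 0$ and every (randomized) learner with top-1 feedback, there are $r_1,\dots,r_T\in\{0,\dots,n\}^m$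 against which its expected regret for DCG is at least $c\,T^{2/3}$. -/

import Mathlib

open MeasureTheory ProbabilityTheory

namespace TopOne

/-! ### Ranking measure

A ranking of the `m` objects is a permutation `σ`; the rank of object `i`, in `{1, …, m}`, is
`σ i + 1` (ranks are stored from `0`), and `σ.symm 0` is the object ranked first. -/

/-- A relevance vector with levels `{0, …, n}`. -/
abbrev Relevance (m n : ℕ) : Type := Fin m → Fin (n + 1)

/-- The rank, in `{1, …, m}`, of object `i`. -/
def rank {m : ℕ} (σ : Equiv.Perm (Fin m)) (i : Fin m) : ℕ := (σ i : ℕ) + 1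

/-- The object placed on top. -/
def topObject {m : ℕ} [NeZero m] (σ : Equiv.Perm (Fin m)) : Fin m := σ.symm 0

/-- `DCG(σ, r) = ∑ i, (2 ^ r(i) - 1) / log₂ (1 + σ(i))`. -/
noncomputable def dcg {m n : ℕ} (σ : Equiv.Perm (Fin m)) (r : Relevance m n) : ℝ :=
  ∑ i, ((2 : ℝ) ^ (r i : ℕ) - 1) / Real.logb 2 (1 + (rank σ i : ℝ))

/-- DCG for binary relevance: `∑ i, r(i) / log₂ (1 + σ(i))`. -/
noncomputable def binaryDCG {m : ℕ} (σ : Equiv.Perm (Fin m)) (r : Relevance m 1) : ℝ :=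
  ∑ i, ((r i : ℕ) : ℝ) / Real.logb 2 (1 + (rank σ i : ℝ))

/-! ### Online ranking with top-1 feedback -/

/-- A (randomized) learner for the game with `m` objects, relevance levels `{0, …, n}` and horizon
`T`. It draws its internal randomness `ω` from `μ`; in round `t` it outputs the ranking
`act ω t h`, where `h s` is the feedback received in round `s < t`. -/
structure Learner (m n T : ℕ) where
  Ω : Type
  mΩ : MeasurableSpace Ω
  μ : Measure Ω
  prob : IsProbabilityMeasure μ
  act : Ω → (t : Fin T) → (Fin (t : ℕ) → Fin (n + 1)) → Equiv.Perm (Fin m)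
  measurable_act : ∀ t h σ, MeasurableSet {ω | act ω t h = σ}

section Play

variable {m n T : ℕ} [NeZero m]

/-- The feedback received in round `t`: the relevance `r_t(σ_t⁻¹(1))` of the object placed on top,
when the deterministic strategy `a` plays against `r_1, …, r_T`. -/
def feedback (a : (t : Fin T) → (Fin (t : ℕ) → Fin (n + 1)) → Equiv.Perm (Fin m))
    (r : Fin T → Relevance m n) (t : Fin T) : Fin (n + 1) :=
  r t (topObject (a t fun s => feedback a r ⟨s, s.2.trans t.2⟩))
termination_by (t : ℕ)
decreasing_by exact s.2

/-- The ranking `σ_t` output in round `t`. -/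
def played (a : (t : Fin T) → (Fin (t : ℕ) → Fin (n + 1)) → Equiv.Perm (Fin m))
    (r : Fin T → Relevance m n) (t : Fin T) : Equiv.Perm (Fin m) :=
  a t fun s => feedback a r ⟨s, s.2.trans t.2⟩

/-- Expected regret, for a gain function, against the best fixed ranking in hindsight:
`max_σ ∑ t, gain(σ, r_t) - E [∑ t, gain(σ_t, r_t)]`. -/
noncomputable def regret (L : Learner m n T) (gain : Equiv.Perm (Fin m) → Relevance m n → ℝ)
    (r : Fin T → Relevance m n) : ℝ :=
  (Finset.univ.sup' Finset.univ_nonempty fun σ : Equiv.Perm (Fin m) => ∑ t, gain σ (r t)) -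
    ∫ ω, ∑ t, gain (played (L.act ω) r t) (r t) ∂L.μ

end Play

/-! ### Algorithm RTop-1F

The horizon is divided into `K` blocks of `T / K` (integer part) rounds. With rounds and blocks
numbered from `0`, block `k < K` consists of the rounds `k * (T / K), …, (k + 1) * (T / K) - 1`. -/

/-- A rule `M` with `M(y) ∈ argmin_σ σ · y`; ties are broken in an arbitrary (measurable) way. -/
structure ArgminRule (m : ℕ) where
  toFun : (Fin m → ℝ) → Equiv.Perm (Fin m)
  isArgmin : ∀ (y : Fin m → ℝ) (σ : Equiv.Perm (Fin m)),
    ∑ i, (rank (toFun y) i : ℝ) * y i ≤ ∑ i, (rank σ i : ℝ) * y i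
  measurable : ∀ σ, MeasurableSet {y | toFun y = σ}

section Algorithm

variable {m n T K : ℕ}

/-- The internal randomness: for each block, `m` positions inside the block, and for each round a
perturbation vector. -/
abbrev Randomness (m T K : ℕ) : Type :=
  (Fin K → Fin m → Fin (T / K)) × (Fin T → Fin m → ℝ)

/-- In each block, `m` positions drawn uniformly at random without replacement; in each round, a
vector drawn uniformly from `[0, 1/ε]^m`; all draws are independent. -/
noncomputable def randomness (m T K : ℕ) (ε : ℝ) : Measure (Randomness m T K) :=
  (Measure.pi fun _ : Fin K => uniformOn {f : Fin m → Fin (T / K) | Function.Injective f}).prod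
    (Measure.pi fun _ : Fin T => Measure.pi fun _ : Fin m => cond volume (Set.Icc (0 : ℝ) (1 / ε)))

theorem isProbabilityMeasure_randomness {ε : ℝ} (hB : m ≤ T / K) (hε : 0 < ε) :
    IsProbabilityMeasure (randomness m T K ε) := by
  have h1 : IsProbabilityMeasure (uniformOn {f : Fin m → Fin (T / K) | Function.Injective f}) :=
    isProbabilityMeasure_uniformOn (Set.toFinite _) ⟨Fin.castLE hB, Fin.castLE_injective hB⟩
  have h2 : IsProbabilityMeasure (cond (volume : Measure ℝ) (Set.Icc (0 : ℝ) (1 / ε))) := by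
    refine cond_isProbabilityMeasure_of_finite ?_ ?_
    · simp [Real.volume_Icc, hε]
    · simp [Real.volume_Icc]
  unfold randomness
  infer_instance

/-- The round at which object `j` is explored in block `k`. -/
def exploreRound (τ : Fin K → Fin m → Fin (T / K)) (k : Fin K) (j : Fin m) : ℕ :=
  (k : ℕ) * (T / K) + (τ k j : ℕ)

theorem exploreRound_lt (τ : Fin K → Fin m → Fin (T / K)) {k : Fin K} (j : Fin m) {t : ℕ}
    (hk : (k : ℕ) < t / (T / K)) : exploreRound τ k j < t := by
  have h1 : ((k : ℕ) + 1) * (T / K) ≤ t / (T / K) * (T / K) := Nat.mul_le_mul_right _ hk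
  have h2 := Nat.div_mul_le_self t (T / K)
  have h3 := (τ k j).2
  have h4 : ((k : ℕ) + 1) * (T / K) = (k : ℕ) * (T / K) + T / K := by ring
  unfold exploreRound
  omega

/-- The score vector `ŝ` used in round `t`: the sum, over the blocks that precede the block of `t`,
of the estimates `r̂_k = [g(r_{k_1}(1)), …, g(r_{k_m}(m))]`, read off from the feedback `h` of the
exploration rounds. -/
def score (g : Fin (n + 1) → ℝ) (τ : Fin K → Fin m → Fin (T / K)) (t : ℕ)
    (h : Fin t → Fin (n + 1)) (j : Fin m) : ℝ :=
  ∑ k : Fin K, if hk : (k : ℕ) < t / (T / K)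
    then g (h ⟨exploreRound τ k j, exploreRound_lt τ j hk⟩) else 0

open Classical in
/-- The ranking output in round `t`: `explore t j` if `t` is the round at which object `j` is
explored, and `M(ŝ + p_t)` otherwise. The fewer than `K` rounds left over when `K` does not divide
`T` are of the latter kind. -/
noncomputable def rtop1fAct (g : Fin (n + 1) → ℝ) (M : ArgminRule m)
    (explore : Fin T → Fin m → Equiv.Perm (Fin m)) (ω : Randomness m T K) (t : Fin T)
    (h : Fin (t : ℕ) → Fin (n + 1)) : Equiv.Perm (Fin m) :=
  if hx : ∃ kj : Fin K × Fin m, (t : ℕ) = exploreRound ω.1 kj.1 kj.2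
  then explore t hx.choose.2
  else M.toFun (score g ω.1 t h + ω.2 t)

theorem measurableSet_rtop1fAct (g : Fin (n + 1) → ℝ) (M : ArgminRule m)
    (explore : Fin T → Fin m → Equiv.Perm (Fin m)) (t : Fin T)
    (h : Fin (t : ℕ) → Fin (n + 1)) (σ : Equiv.Perm (Fin m)) :
    MeasurableSet {ω : Randomness m T K | rtop1fAct g M explore ω t h = σ} := by
  have key : {ω : Randomness m T K | rtop1fAct g M explore ω t h = σ} =
      ⋃ τ : Fin K → Fin m → Fin (T / K),
        {τ} ×ˢ {p | rtop1fAct g M explore (τ, p) t h = σ} := by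
    ext ⟨τ, p⟩
    simp
  rw [key]
  refine MeasurableSet.iUnion fun τ => (MeasurableSet.singleton τ).prod ?_
  by_cases hx : ∃ kj : Fin K × Fin m, (t : ℕ) = exploreRound τ kj.1 kj.2
  · simp only [rtop1fAct, hx, dite_true]
    exact MeasurableSet.const (explore t hx.choose.2 = σ)
  · simp only [rtop1fAct, hx, dite_false]
    have hm : Measurable fun p : Fin T → Fin m → ℝ => score g τ t h + p t := by fun_prop
    exact hm (M.measurable σ)

/-- Algorithm RTop-1F with `K` blocks and randomization parameter `ε`. The relevances enter through
the transformation `g`, and `explore t j` is the ranking played when object `j` is explored in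
round `t`. -/
noncomputable def rtop1f (g : Fin (n + 1) → ℝ) (M : ArgminRule m)
    (explore : Fin T → Fin m → Equiv.Perm (Fin m)) (K : ℕ) (ε : ℝ)
    (hB : m ≤ T / K) (hε : 0 < ε) : Learner m n T where
  Ω := Randomness m T K
  mΩ := inferInstance
  μ := randomness m T K ε
  prob := isProbabilityMeasure_randomness hB hε
  act := rtop1fAct g M explore
  measurable_act := measurableSet_rtop1fAct g M explore

/-- The number of blocks `K = m ^ (-1/3) T ^ (2/3)`, rounded down to an integer. -/
noncomputable def numBlocks (m T : ℕ) : ℕ :=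
  ⌊(m : ℝ) ^ (-(1 / 3) : ℝ) * (T : ℝ) ^ (2 / 3 : ℝ)⌋₊

end Algorithm

/-! ### Local observability of the DCG game with top-1 feedback -/

section Observability

variable {m n : ℕ}

/-- The row of the gain matrix that belongs to the learner's action `σ`. -/
noncomputable def gainRow (n : ℕ) (σ : Equiv.Perm (Fin m)) : Relevance m n → ℝ := fun r => dcg σ r

/-- The probability cell of `σ`: the distributions over outcomes under which `σ` is optimal. -/
def cell (n : ℕ) (σ : Equiv.Perm (Fin m)) : Set (Relevance m n → ℝ) :=
  {p | p ∈ stdSimplex ℝ (Relevance m n) ∧ ∀ σ', gainRow n σ' ⬝ᵥ p ≤ gainRow n σ ⬝ᵥ p}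

/-- `C` is non-empty of (affine) dimension `d`. -/
def HasDimension {E : Type*} [AddCommGroup E] [Module ℝ E] (C : Set E) (d : ℕ) : Prop :=
  C.Nonempty ∧ Module.finrank ℝ (vectorSpan ℝ C) = d

/-- The cell of `σ` has full dimension in the simplex: `(n + 1) ^ m - 1`. -/
def IsParetoOptimal (n : ℕ) (σ : Equiv.Perm (Fin m)) : Prop :=
  HasDimension (cell n σ) ((n + 1) ^ m - 1)

/-- Pareto-optimal actions whose cells meet in a set of dimension `(n + 1) ^ m - 2`. -/
def IsNeighboring (n : ℕ) (σ σ' : Equiv.Perm (Fin m)) : Prop :=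
  IsParetoOptimal n σ ∧ IsParetoOptimal n σ' ∧ σ ≠ σ' ∧
    HasDimension (cell n σ ∩ cell n σ') ((n + 1) ^ m - 2)

/-- The neighborhood action set of two actions. -/
def neighborhoodSet (n : ℕ) (σ σ' : Equiv.Perm (Fin m)) : Set (Equiv.Perm (Fin m)) :=
  {κ | cell n σ ∩ cell n σ' ⊆ cell n κ}

/-- The signal matrix of `σ`: the entry in row `v` and column `r` is `1` if the feedback of `σ` under
the outcome `r` is `v`, and `0` otherwise. -/
def signalMatrix [NeZero m] (n : ℕ) (σ : Equiv.Perm (Fin m)) :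
    Matrix (Fin (n + 1)) (Relevance m n) ℝ :=
  Matrix.of fun v r => if r (topObject σ) = v then 1 else 0

/-- For every pair of neighboring actions, the difference of their rows lies in the sum of the column
spaces of the transposed signal matrices of the actions in their neighborhood action set. -/
def LocallyObservable (m n : ℕ) [NeZero m] : Prop :=
  ∀ σ σ' : Equiv.Perm (Fin m), IsNeighboring n σ σ' →
    gainRow n σ - gainRow n σ' ∈
      ⨆ κ ∈ neighborhoodSet n σ σ',
        LinearMap.range (Matrix.mulVecLin (Matrix.transpose (signalMatrix n κ)))

end Observability

end TopOne

/-! Discounts decrease strictly with rank, so the best ranking for a score vector sorts it, and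
exchanging two objects changes the gain by a product of two differences. Everything rests on this.

Upper bound. Let `B = T / K` and let `G` bound the transformed relevances. The position where an
object is explored is uniform in its block and independent of the other blocks. Hence `B` times the
observed value is unbiased for the block sum, even after multiplication by a weight that depends
only on other blocks (`sum_exploration_mul`). The regret inside the blocks is therefore at most `B`
times the regret of a perturbed leader on the `K` estimate vectors, which is at most `m / ε + ε * K
* (m * G) ^ 2` (`follow_perturbed_leader`), plus at most `m * G` for each of the `K * m` exploration
rounds. Fewer than `K` rounds are left over. `tuned_bound_le` balances these terms.

Observability. The identity ranking and the exchange of the objects at ranks 2 and 3 are neighbors,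
but every ranking in their neighborhood has object `0` on top. Its signals depend on `r 0` only,
whereas the row difference depends on the exchanged objects (`not_locallyObservable`).

Lower bound. Object `0` is always relevant, and a coin of bias `1/2 ± δ` decides which of objects
`1`, `2` is relevant. Only rankings with `1` or `2` on top reveal the coin, and they lose at least
`1/12`. Without the coin no ranking is good under both signs of the bias: the two losses sum to
order `δ`. The potential `u * v / (u + v)` of the unnormalized posterior weights makes this tradeoff
exact (`harmonic_le_averageTotal`), and `δ` of order `T ^ (-1/3)` gives `T ^ (2/3)`. -/

namespace TopOne

/-! ### Discounts and the rearrangement inequality -/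

section Discount

variable {m n : ℕ}

/-- The discount `1 / log₂ (1 + ρ)` of the rank `ρ = k + 1`. -/
noncomputable def discount (k : ℕ) : ℝ := 1 / Real.logb 2 (1 + ((k + 1 : ℕ) : ℝ))

theorem one_le_logb_two_rank (k : ℕ) : 1 ≤ Real.logb 2 (1 + ((k + 1 : ℕ) : ℝ)) := by
  rw [Real.le_logb_iff_rpow_le (by norm_num) (by positivity)]
  push_cast
  have : (0 : ℝ) ≤ k := k.cast_nonneg
  norm_num
  linarith

theorem discount_pos (k : ℕ) : 0 < discount k :=
  one_div_pos.2 (one_pos.trans_le (one_le_logb_two_rank k))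

theorem discount_le_one (k : ℕ) : discount k ≤ 1 := by
  unfold discount
  rw [div_le_one (one_pos.trans_le (one_le_logb_two_rank k))]
  exact one_le_logb_two_rank k

theorem discount_strictAnti : StrictAnti discount := by
  intro a b hab
  unfold discount
  refine one_div_lt_one_div_of_lt (one_pos.trans_le (one_le_logb_two_rank a)) ?_
  refine Real.logb_lt_logb (by norm_num) (by positivity) ?_
  have : (a : ℝ) < b := by exact_mod_cast hab
  push_cast
  linarith

theorem discount_zero : discount 0 = 1 := by
  norm_num [discount]

/-- From `2 ^ 3 ≤ 3 ^ 2` and `3 ^ 5 ≤ 2 ^ 8`. In the lower bound these make the gaps from `discount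
1` to `discount 0 = 1` and to `discount 2 = 1 / 2` explicit. -/
theorem discount_one_mem : discount 1 ∈ Set.Icc (5 / 8 : ℝ) (2 / 3) := by
  have h : discount 1 = 1 / Real.logb 2 3 := by norm_num [discount]
  have hlo : (3 / 2 : ℝ) ≤ Real.logb 2 3 := by
    have h2 : Real.logb 2 ((3 : ℝ) ^ 2) = 2 * Real.logb 2 3 := by
      rw [Real.logb_pow]; norm_num
    have h3 : (3 : ℝ) ≤ Real.logb 2 ((3 : ℝ) ^ 2) := by
      rw [Real.le_logb_iff_rpow_le (by norm_num) (by positivity)]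
      norm_num
    linarith
  have hhi : Real.logb 2 3 ≤ (8 / 5 : ℝ) := by
    have h2 : Real.logb 2 ((3 : ℝ) ^ 5) = 5 * Real.logb 2 3 := by
      rw [Real.logb_pow]; norm_num
    have h3 : Real.logb 2 ((3 : ℝ) ^ 5) ≤ (8 : ℝ) := by
      rw [Real.logb_le_iff_le_rpow (by norm_num) (by positivity)]
      norm_num
    linarith
  rw [h]
  constructor
  · rw [le_div_iff₀ (by linarith)]; linarith
  · rw [div_le_iff₀ (by linarith)]; linarith

theorem discount_two : discount 2 = 1 / 2 := by
  have : Real.logb 2 4 = 2 := by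
    rw [show (4 : ℝ) = 2 ^ (2 : ℕ) by norm_num, Real.logb_pow]; norm_num
  norm_num [discount, this]

theorem two_pow_sub_one_pos (hn : 1 ≤ n) : (0 : ℝ) < 2 ^ n - 1 :=
  sub_pos.2 (one_lt_pow₀ (by norm_num) (by omega))

theorem dcg_eq (σ : Equiv.Perm (Fin m)) (r : Relevance m n) :
    dcg σ r = ∑ i, discount (σ i) * ((2 : ℝ) ^ (r i : ℕ) - 1) := by
  refine Finset.sum_congr rfl fun i _ => ?_
  simp only [discount, rank]
  ring

theorem binaryDCG_eq (σ : Equiv.Perm (Fin m)) (r : Relevance m 1) :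
    binaryDCG σ r = ∑ i, discount (σ i) * ((r i : ℕ) : ℝ) := by
  refine Finset.sum_congr rfl fun i _ => ?_
  simp only [discount, rank]
  ring

/-- Ranking by decreasing score maximizes the discounted sum of the scores. -/
theorem sum_discount_mul_le {σ : Equiv.Perm (Fin m)} {y : Fin m → ℝ}
    (h : ∀ i j, σ i < σ j → y j ≤ y i) (σ' : Equiv.Perm (Fin m)) :
    ∑ i, discount (σ' i) * y i ≤ ∑ i, discount (σ i) * y i := by
  have hmono : Monovary (fun i => discount (σ i)) y := by
    intro i j hij
    refine discount_strictAnti.antitone ?_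
    by_contra hlt
    exact absurd (h i j (by simpa using hlt)) (not_le.2 hij)
  have := hmono.sum_comp_perm_mul_le_sum_mul (σ := σ'.trans σ.symm)
  simpa using this

/-- Effect on a weighted sum of exchanging the positions of two objects. -/
theorem sum_swap_mul (f : Fin m → ℝ) (y : Fin m → ℝ) (i j : Fin m) :
    ∑ x, f (Equiv.swap i j x) * y x = ∑ x, f x * y x + (f j - f i) * (y i - y j) := by
  rcases eq_or_ne i j with rfl | hij
  · simp
  rw [← sub_eq_iff_eq_add', ← Finset.sum_sub_distrib]
  rw [Finset.sum_eq_add i j hij]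
  · simp; ring
  · rintro c - ⟨h1, h2⟩
    rw [Equiv.swap_apply_of_ne_of_ne h1 h2, sub_self]
  · simp
  · simp

end Discount

/-! ### Cells of the DCG game -/

section Cells

/-- A set that lies in a translate of `W`, and is a neighborhood of one of its points there, spans
the direction `W`. -/
theorem vectorSpan_eq_of_isOpen {E : Type*} [NormedAddCommGroup E] [NormedSpace ℝ E] {C U : Set E}
    {W : Submodule ℝ E} {p : E} (hsub : ∀ x ∈ C, ∀ y ∈ C, x - y ∈ W) (hU : IsOpen U) (hp : p ∈ U)
    (hC : ∀ v ∈ W, p + v ∈ U → p + v ∈ C) : vectorSpan ℝ C = W := by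
  apply le_antisymm
  · rw [vectorSpan_def, Submodule.span_le]
    rintro _ ⟨x, hx, y, hy, rfl⟩
    exact hsub x hx y hy
  · intro v hv
    have hcont : Filter.Tendsto (fun s : ℝ => p + s • v) (nhds 0) (nhds p) := by
      have : Continuous fun s : ℝ => p + s • v := by fun_prop
      simpa using this.tendsto 0
    have hev : ∀ᶠ s : ℝ in nhds 0, p + s • v ∈ U := hcont.eventually (hU.mem_nhds hp)
    -- A small nonzero multiple of `v` keeps the point in `U`; dividing by `s` recovers `v`.
    obtain ⟨s, hs, hs0⟩ := ((hev.filter_mono nhdsWithin_le_nhds).and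
      (self_mem_nhdsWithin (a := (0 : ℝ)) (s := {0}ᶜ))).exists
    have h1 : p + s • v ∈ C := hC _ (W.smul_mem s hv) hs
    have h2 : p ∈ C := by simpa using hC 0 W.zero_mem (by simpa using hp)
    have h3 : s • v ∈ vectorSpan ℝ C := by
      simpa using vsub_mem_vectorSpan ℝ h1 h2
    exact (Submodule.smul_mem_iff _ hs0).1 h3

variable {m n : ℕ}

/-- The expected gain `2 ^ r(i) - 1` of object `i`, as a linear function of the distribution. -/
noncomputable def meanGain (i : Fin m) : (Relevance m n → ℝ) →ₗ[ℝ] ℝ :=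
  ∑ r : Relevance m n, ((2 : ℝ) ^ (r i : ℕ) - 1) • LinearMap.proj r

theorem meanGain_apply (i : Fin m) (p : Relevance m n → ℝ) :
    meanGain i p = ∑ r, ((2 : ℝ) ^ (r i : ℕ) - 1) * p r := by
  simp [meanGain]

theorem gainRow_dotProduct (σ : Equiv.Perm (Fin m)) (p : Relevance m n → ℝ) :
    gainRow n σ ⬝ᵥ p = ∑ i, discount (σ i) * meanGain i p := by
  simp only [dotProduct, gainRow, dcg_eq, meanGain_apply, Finset.sum_mul, Finset.mul_sum]
  rw [Finset.sum_comm]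
  exact Finset.sum_congr rfl fun _ _ => Finset.sum_congr rfl fun _ _ => by ring

theorem mem_cell_of_meanGain {σ : Equiv.Perm (Fin m)} {p : Relevance m n → ℝ}
    (hp : p ∈ stdSimplex ℝ (Relevance m n))
    (h : ∀ i j, σ i < σ j → meanGain j p ≤ meanGain i p) : p ∈ cell n σ := by
  refine ⟨hp, fun σ' => ?_⟩
  rw [gainRow_dotProduct, gainRow_dotProduct]
  exact sum_discount_mul_le h σ'

/-- Positive vectors with prescribed strict comparisons of the expected gains. -/
def strictRegion (n : ℕ) (R : Fin m → Fin m → Prop) : Set (Relevance m n → ℝ) :=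
  {p | (∀ r, 0 < p r) ∧ ∀ i j, R i j → meanGain j p < meanGain i p}

theorem isOpen_strictRegion (R : Fin m → Fin m → Prop) : IsOpen (strictRegion n R) := by
  have hc : ∀ i : Fin m, Continuous fun p : Relevance m n → ℝ => meanGain i p := fun i =>
    LinearMap.continuous_of_finiteDimensional _
  simp only [strictRegion, Set.ofPred_and, Set.ofPred_forall]
  refine IsOpen.inter (isOpen_iInter_of_finite fun r => isOpen_lt continuous_const
    (continuous_apply r)) ?_
  refine isOpen_iInter_of_finite fun i => isOpen_iInter_of_finite fun j =>
    isOpen_iInter_of_finite fun _ => isOpen_lt (hc j) (hc i)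

/-- The outcome in which only object `i` is relevant, at the highest level. -/
def onlyRelevant (n : ℕ) (i : Fin m) : Relevance m n := Pi.single i (Fin.last n)

theorem two_pow_onlyRelevant (i j : Fin m) :
    (2 : ℝ) ^ (onlyRelevant n i j : ℕ) - 1 = if i = j then 2 ^ n - 1 else 0 := by
  rcases eq_or_ne i j with rfl | h
  · simp [onlyRelevant]
  · simp [onlyRelevant, h]

theorem sum_two_pow_eq (i j : Fin m) :
    ∑ r : Relevance m n, ((2 : ℝ) ^ (r i : ℕ) - 1) = ∑ r : Relevance m n, ((2 : ℝ) ^ (r j : ℕ) - 1) :=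
  Fintype.sum_equiv ((Equiv.swap i j).arrowCongr (Equiv.refl _)) _ _ fun r => by
    simp [Equiv.arrowCongr]

/-- There are positive distributions whose expected gains are ordered like a given vector. -/
theorem exists_distribution (c : Fin m → ℝ) (hc : ∀ i, 0 < c i) (hn : 1 ≤ n) :
    ∃ p : Relevance m n → ℝ, (∀ r, 0 < p r) ∧ ∑ r, p r = 1 ∧
      ∃ a b : ℝ, 0 < b ∧ ∀ i, meanGain i p = a + b * c i := by
  -- The constant part gives all objects the same expected gain, and an atom of mass `c i` at
  -- `onlyRelevant n i` raises object `i` alone by `(2 ^ n - 1) * c i`. Normalization comes last.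
  set w : Relevance m n → ℝ := fun r => 1 + ∑ i, c i * if r = onlyRelevant n i then 1 else 0 with hw
  have hpos : ∀ r, 0 < w r := fun r => by
    have : 0 ≤ ∑ i, c i * (if r = onlyRelevant n i then (1 : ℝ) else 0) :=
      Finset.sum_nonneg fun i _ => mul_nonneg (hc i).le (by split_ifs <;> norm_num)
    simp only [hw]; linarith
  have hZ : 0 < ∑ r, w r := Finset.sum_pos (fun r _ => hpos r) Finset.univ_nonempty
  have hn' : (0 : ℝ) < 2 ^ n - 1 := two_pow_sub_one_pos hn
  have hmean : ∀ i, meanGain i w =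
      ∑ r : Relevance m n, ((2 : ℝ) ^ (r i : ℕ) - 1) + (2 ^ n - 1) * c i := by
    intro i
    simp only [meanGain_apply, hw, mul_add, mul_one, Finset.sum_add_distrib, Finset.mul_sum]
    congr 1
    rw [Finset.sum_comm]
    simp only [mul_ite, mul_one, mul_zero, Finset.sum_ite_eq', Finset.mem_univ, if_true,
      two_pow_onlyRelevant, ite_mul, zero_mul]
  refine ⟨(∑ r, w r)⁻¹ • w, fun r => mul_pos (inv_pos.2 hZ) (hpos r), ?_, ?_⟩
  · simp only [Pi.smul_apply, smul_eq_mul, ← Finset.mul_sum]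
    exact inv_mul_cancel₀ hZ.ne'
  · rcases isEmpty_or_nonempty (Fin m) with hm | ⟨⟨i₀⟩⟩
    · exact ⟨0, 1, one_pos, fun i => (hm.false i).elim⟩
    refine ⟨(∑ r, w r)⁻¹ * ∑ r : Relevance m n, ((2 : ℝ) ^ (r i₀ : ℕ) - 1),
      (∑ r, w r)⁻¹ * (2 ^ n - 1), mul_pos (inv_pos.2 hZ) hn', fun i => ?_⟩
    rw [map_smul, hmean, sum_two_pow_eq i i₀, smul_eq_mul]
    ring

/-- The linear form `p ↦ ∑ p`. -/
noncomputable def totalMass (m n : ℕ) : (Relevance m n → ℝ) →ₗ[ℝ] ℝ :=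
  ∑ r : Relevance m n, LinearMap.proj r

theorem totalMass_apply (p : Relevance m n → ℝ) : totalMass m n p = ∑ r, p r := by
  simp [totalMass]

theorem finrank_relevance : Module.finrank ℝ (Relevance m n → ℝ) = (n + 1) ^ m := by
  simp

/-- Around a positive distribution whose expected gains decrease strictly with rank, optimality
survives every small perturbation of total mass zero, so the cell spans a hyperplane. -/
theorem isParetoOptimal (hn : 1 ≤ n) (σ : Equiv.Perm (Fin m)) : IsParetoOptimal n σ := by
  obtain ⟨p, hpos, hsum, a, b, hb, hmean⟩ :=
    exists_distribution (n := n) (fun i : Fin m => (m : ℝ) - (σ i : ℕ))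
      (fun i => sub_pos.2 (by exact_mod_cast (σ i).2)) hn
  have hmem : ∀ v ∈ LinearMap.ker (totalMass m n), p + v ∈ strictRegion n (fun i j => σ i < σ j) →
      p + v ∈ cell n σ := by
    intro v hv hU
    refine mem_cell_of_meanGain ⟨fun r => (hU.1 r).le, ?_⟩ fun i j hij => (hU.2 i j hij).le
    rw [LinearMap.mem_ker, totalMass_apply] at hv
    simp [Finset.sum_add_distrib, hsum, hv]
  have hp : p ∈ strictRegion n (fun i j => σ i < σ j) := by
    refine ⟨hpos, fun i j hij => ?_⟩
    have : ((σ i : ℕ) : ℝ) < (σ j : ℕ) := by exact_mod_cast hij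
    rw [hmean, hmean]
    nlinarith
  refine ⟨⟨p, by simpa using hmem 0 (Submodule.zero_mem _) (by simpa using hp)⟩, ?_⟩
  rw [vectorSpan_eq_of_isOpen (W := LinearMap.ker (totalMass m n)) ?_
    (isOpen_strictRegion fun i j => σ i < σ j) hp hmem]
  · have hsurj : Function.Surjective (totalMass m n) := by
      intro x
      refine ⟨Pi.single 0 x, ?_⟩
      simp [totalMass_apply]
    have := (totalMass m n).finrank_range_add_finrank_ker
    rw [LinearMap.range_eq_top.2 hsurj, finrank_top, Module.finrank_self, finrank_relevance] at this
    omega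
  · intro x hx y hy
    rw [LinearMap.mem_ker, totalMass_apply]
    simp [hx.1.2, hy.1.2]

/-- Both rankings are optimal, so the gain difference, a product of a discount gap and a mean gap,
vanishes; the discount gap does not. -/
theorem meanGain_eq_of_mem_cell {a b : Fin m} (hab : a ≠ b) {p : Relevance m n → ℝ}
    (h1 : p ∈ cell n (1 : Equiv.Perm (Fin m))) (h2 : p ∈ cell n (Equiv.swap a b)) :
    meanGain a p = meanGain b p := by
  have h := le_antisymm (h1.2 (Equiv.swap a b)) (h2.2 1)
  rw [gainRow_dotProduct, gainRow_dotProduct,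
    sum_swap_mul (fun i : Fin m => discount i) (fun i => meanGain i p)] at h
  simp only [Equiv.Perm.coe_one, id_eq, add_eq_left, mul_eq_zero, sub_eq_zero] at h
  rcases h with h | h
  · exact absurd (Fin.ext (discount_strictAnti.injective h)) hab.symm
  · exact h

/-- The intersection of the cells is cut out by one further equation, the tie between `a` and `b`.
Near a point where all other comparisons are strict it fills this subspace of codimension two. -/
theorem isNeighboring_swap (hn : 1 ≤ n) {a b : Fin m} (hab : (b : ℕ) = a + 1) :
    IsNeighboring n (1 : Equiv.Perm (Fin m)) (Equiv.swap a b) := by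
  have hne : a ≠ b := by rintro rfl; omega
  refine ⟨isParetoOptimal hn _, isParetoOptimal hn _, fun h => hne ?_, ?_⟩
  · have := congrArg (fun e : Equiv.Perm (Fin m) => e a) h
    simpa using this
  set R : Fin m → Fin m → Prop := fun i j => i < j ∧ ¬ (i = a ∧ j = b) with hR
  -- Scores decreasing with the index, except that `a` is given the score of `b`; adjacency keeps
  -- all other comparisons strict.
  set c : Fin m → ℝ := fun i => (m : ℝ) - (if i = a then b else i : Fin m) with hc
  obtain ⟨p, hpos, hsum, α, β, hβ, hmean⟩ := exists_distribution (n := n) c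
    (fun i => sub_pos.2 (by exact_mod_cast (if i = a then b else i : Fin m).2)) hn
  set L : (Relevance m n → ℝ) →ₗ[ℝ] ℝ × ℝ := (totalMass m n).prod (meanGain a - meanGain b) with hL
  have hLapp : ∀ v, L v = (totalMass m n v, meanGain a v - meanGain b v) := fun _ => rfl
  have hker : ∀ v, v ∈ LinearMap.ker L ↔ ∑ r, v r = 0 ∧ meanGain a v = meanGain b v := by
    intro v
    rw [LinearMap.mem_ker, hLapp, Prod.mk_eq_zero, totalMass_apply, sub_eq_zero]
  have hpab : meanGain a p = meanGain b p := by
    rw [hmean, hmean]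
    simp only [hc, if_true, if_neg hne.symm]
  have hmem : ∀ v ∈ LinearMap.ker L, p + v ∈ strictRegion n R →
      p + v ∈ cell n 1 ∩ cell n (Equiv.swap a b) := by
    intro v hv hU
    rw [hker] at hv
    have hs : p + v ∈ stdSimplex ℝ (Relevance m n) :=
      ⟨fun r => (hU.1 r).le, by simp [Finset.sum_add_distrib, hsum, hv.1]⟩
    have heq : meanGain a (p + v) = meanGain b (p + v) := by
      rw [map_add, map_add, hpab, hv.2]
    have hle : ∀ i j, i < j → meanGain j (p + v) ≤ meanGain i (p + v) := by
      intro i j hij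
      by_cases h : i = a ∧ j = b
      · rw [h.1, h.2, heq]
      · exact (hU.2 i j ⟨hij, h⟩).le
    refine ⟨mem_cell_of_meanGain hs hle, mem_cell_of_meanGain hs fun i j hij => ?_⟩
    by_cases h : i = b ∧ j = a
    · rw [h.1, h.2, heq]
    · refine hle i j ?_
      rw [Equiv.swap_apply_def, Equiv.swap_apply_def] at hij
      simp only [Fin.ext_iff, Fin.lt_def] at *
      split_ifs at hij <;> omega
  have hp : p ∈ strictRegion n R := by
    refine ⟨hpos, fun i j hij => ?_⟩
    have h : ((if i = a then b else i : Fin m) : ℕ) < (if j = a then b else j : Fin m) := by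
      simp only [hR, Fin.ext_iff, Fin.lt_def] at *
      split_ifs <;> omega
    have h' : (((if i = a then b else i : Fin m) : ℕ) : ℝ) < ((if j = a then b else j : Fin m) : ℕ) :=
      by exact_mod_cast h
    rw [hmean, hmean]
    simp only [hc]
    nlinarith
  refine ⟨⟨p, by simpa using hmem 0 (Submodule.zero_mem _) (by simpa using hp)⟩, ?_⟩
  rw [vectorSpan_eq_of_isOpen (W := LinearMap.ker L) ?_ (isOpen_strictRegion R) hp hmem]
  · have hn' : (0 : ℝ) < 2 ^ n - 1 := two_pow_sub_one_pos hn
    have hsurj : Function.Surjective L := by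
      rintro ⟨x, y⟩
      -- The outcome `0` carries mass but no gain, while `onlyRelevant n a` separates the two mean
      -- gains.
      refine ⟨Pi.single 0 (x - y / (2 ^ n - 1)) +
        Pi.single (onlyRelevant n a) (y / (2 ^ n - 1)), ?_⟩
      rw [hLapp]
      simp only [totalMass_apply, meanGain_apply, Pi.single_apply, Pi.add_apply, mul_add,
        Finset.sum_add_distrib, mul_ite, mul_zero,
        Finset.sum_ite_eq', Finset.mem_univ, if_true, two_pow_onlyRelevant, if_neg hne]
      ext
      · simp
      · simp [mul_div_cancel₀ _ hn'.ne']
    have := L.finrank_range_add_finrank_ker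
    rw [LinearMap.range_eq_top.2 hsurj, finrank_top, Module.finrank_prod, Module.finrank_self,
      finrank_relevance] at this
    omega
  · rintro x ⟨hx1, hx2⟩ y ⟨hy1, hy2⟩
    rw [hker]
    constructor
    · simp [hx1.1.2, hy1.1.2]
    · rw [map_sub, map_sub, meanGain_eq_of_mem_cell hne hx1 hx2, meanGain_eq_of_mem_cell hne hy1 hy2]

variable [NeZero m]

/-- Test with the point mass on `onlyRelevant n 0`: a ranking is optimal there only if it puts
object `0` first, and both given rankings do. -/
theorem topObject_of_mem_neighborhoodSet (hn : 1 ≤ n) {a b : Fin m} (ha : a ≠ 0) (hb : b ≠ 0)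
    {κ : Equiv.Perm (Fin m)} (hκ : κ ∈ neighborhoodSet n 1 (Equiv.swap a b)) :
    topObject κ = 0 := by
  set p : Relevance m n → ℝ := Pi.single (onlyRelevant n 0) 1 with hp
  have hn' : (0 : ℝ) < 2 ^ n - 1 := two_pow_sub_one_pos hn
  have hmean : ∀ i, meanGain i p = if 0 = i then 2 ^ n - 1 else 0 := by
    intro i
    simp only [hp, meanGain_apply, Pi.single_apply, mul_ite, mul_zero, mul_one, Finset.sum_ite_eq',
      Finset.mem_univ, if_true, two_pow_onlyRelevant]
  have hs : p ∈ stdSimplex ℝ (Relevance m n) := single_mem_stdSimplex ℝ _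
  have hcell : ∀ σ : Equiv.Perm (Fin m), σ 0 = 0 → p ∈ cell n σ := by
    intro σ hσ
    refine mem_cell_of_meanGain hs fun i j hij => ?_
    have hj : 0 ≠ j := by
      rintro rfl
      rw [hσ] at hij
      exact absurd hij (by simp)
    rw [hmean, hmean, if_neg hj]
    split_ifs
    · exact hn'.le
    · exact le_rfl
  have h := (hκ ⟨hcell 1 rfl, hcell _ (Equiv.swap_apply_of_ne_of_ne ha.symm hb.symm)⟩).2 1
  rw [gainRow_dotProduct, gainRow_dotProduct] at h
  simp only [hmean, mul_ite, mul_zero, Finset.sum_ite_eq, Finset.mem_univ, if_true] at h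
  have h0 : κ 0 = 0 := by
    by_contra hne
    have hlt : (0 : ℕ) < κ 0 := Nat.pos_of_ne_zero fun h => hne (Fin.ext h)
    have := discount_strictAnti hlt
    simp only [Equiv.Perm.coe_one, id_eq, Fin.val_zero] at h
    nlinarith
  rw [topObject, Equiv.symm_apply_eq, h0]

theorem not_locallyObservable (hm : 3 ≤ m) (hn : 1 ≤ n) : ¬ LocallyObservable m n := by
  intro hobs
  set a : Fin m := ⟨1, by omega⟩ with ha
  set b : Fin m := ⟨2, by omega⟩ with hb
  have ha0 : a ≠ 0 := by simp [ha, Fin.ext_iff]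
  have hb0 : b ≠ 0 := by simp [hb, Fin.ext_iff]
  have hab : a ≠ b := by simp [ha, hb]
  -- The vectors that depend on `r 0` alone; they contain all signals available in the neighborhood.
  let V : Submodule ℝ (Relevance m n → ℝ) :=
    { carrier := {w | ∀ r r' : Relevance m n, r 0 = r' 0 → w r = w r'}
      add_mem' := fun h h' r r' hr => by simp [h r r' hr, h' r r' hr]
      zero_mem' := fun _ _ _ => rfl
      smul_mem' := fun x w h r r' hr => by simp [h r r' hr] }
  have hle : ⨆ κ ∈ neighborhoodSet n 1 (Equiv.swap a b),
      LinearMap.range (Matrix.mulVecLin (Matrix.transpose (signalMatrix n κ))) ≤ V := by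
    refine iSup₂_le fun κ hκ => ?_
    rintro _ ⟨x, rfl⟩ r r' hr
    have htop := topObject_of_mem_neighborhoodSet hn ha0 hb0 hκ
    simp only [Matrix.mulVecLin_apply, Matrix.mulVec, dotProduct, signalMatrix, htop,
      Matrix.transpose_apply, Matrix.of_apply, hr]
  -- These two outcomes agree at object `0` but differ at `a`, whose rank the exchange changes.
  have h := hle (hobs 1 (Equiv.swap a b) (isNeighboring_swap hn (by simp [ha, hb])))
    (onlyRelevant n a) 0 (by simp [onlyRelevant, Pi.single_eq_of_ne ha0.symm])
  simp only [Pi.sub_apply, gainRow, dcg_eq] at h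
  rw [sum_swap_mul (fun i : Fin m => discount i), sum_swap_mul (fun i : Fin m => discount i)] at h
  simp only [two_pow_onlyRelevant, if_true, if_neg hab] at h
  have hn' : (0 : ℝ) < 2 ^ n - 1 := two_pow_sub_one_pos hn
  have hd : discount 2 < discount 1 := discount_strictAnti (by norm_num)
  simp [ha, hb] at h
  rcases h with h | h
  · linarith
  · linarith

end Cells

/-! ### Measurability and one-step unfolding of the play -/

section PlayLemmas

variable {m n T : ℕ} [NeZero m]

theorem feedback_eq (a : (t : Fin T) → (Fin (t : ℕ) → Fin (n + 1)) → Equiv.Perm (Fin m))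
    (r : Fin T → Relevance m n) (t : Fin T) : feedback a r t = r t (topObject (played a r t)) := by
  rw [feedback, played]

/-- Strong induction on the round: the event splits over the finitely many feedback histories, and
feedback is determined by earlier rankings. -/
theorem measurableSet_played (L : Learner m n T) (r : Fin T → Relevance m n) (t : Fin T)
    (σ : Equiv.Perm (Fin m)) : MeasurableSet[L.mΩ] {ω | played (L.act ω) r t = σ} := by
  let _ := L.mΩ
  obtain ⟨t, ht⟩ := t
  induction t using Nat.strong_induction_on generalizing σ with
  | _ t ih =>
  have hfb : ∀ (s : Fin t) (y : Fin (n + 1)),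
      MeasurableSet {ω | feedback (L.act ω) r ⟨s, s.2.trans ht⟩ = y} := by
    intro s y
    have : {ω | feedback (L.act ω) r ⟨s, s.2.trans ht⟩ = y} =
        ⋃ σ ∈ {σ : Equiv.Perm (Fin m) | r ⟨s, s.2.trans ht⟩ (topObject σ) = y},
          {ω | played (L.act ω) r ⟨s, s.2.trans ht⟩ = σ} := by
      ext ω
      simp [feedback_eq]
    rw [this]
    exact MeasurableSet.biUnion (Set.to_countable _) fun σ _ => ih s s.2 σ _
  have : {ω | played (L.act ω) r ⟨t, ht⟩ = σ} =
      ⋃ h : Fin t → Fin (n + 1), {ω | L.act ω ⟨t, ht⟩ h = σ} ∩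
        ⋂ s : Fin t, {ω | feedback (L.act ω) r ⟨s, s.2.trans ht⟩ = h s} := by
    ext ω
    simp only [Set.mem_ofPred_eq, Set.mem_iUnion, Set.mem_inter_iff, Set.mem_iInter]
    constructor
    · intro h
      exact ⟨fun s => feedback (L.act ω) r ⟨s, s.2.trans ht⟩, h, fun _ => rfl⟩
    · rintro ⟨h, h1, h2⟩
      rw [played, ← h1]
      congr 1
      exact funext h2
  rw [this]
  exact MeasurableSet.iUnion fun h => (L.measurable_act _ _ _).inter
    (MeasurableSet.iInter fun s => hfb s _)

theorem integrable_played (L : Learner m n T) (r : Fin T → Relevance m n) (t : Fin T)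
    (F : Equiv.Perm (Fin m) → ℝ) :
    @Integrable _ _ _ _ L.mΩ (fun ω => F (played (L.act ω) r t)) L.μ := by
  let _ := L.mΩ
  have := L.prob
  let _ : MeasurableSpace (Equiv.Perm (Fin m)) := ⊤
  have hm : Measurable fun ω => played (L.act ω) r t :=
    measurable_to_countable' fun σ => measurableSet_played L r t σ
  refine Integrable.of_bound ((measurable_from_top (f := F)).comp hm).aestronglyMeasurable
    (∑ σ, |F σ|) (Filter.Eventually.of_forall fun ω => ?_)
  exact Finset.single_le_sum (f := fun σ => |F σ|) (fun _ _ => abs_nonneg _) (Finset.mem_univ _)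

/-- The strategy that remains after the first round, in which the feedback was `y`. -/
def tailStrategy (a : (t : Fin (T + 1)) → (Fin (t : ℕ) → Fin (n + 1)) → Equiv.Perm (Fin m))
    (y : Fin (n + 1)) : (t : Fin T) → (Fin (t : ℕ) → Fin (n + 1)) → Equiv.Perm (Fin m) :=
  fun t h => a t.succ (Fin.cons (α := fun _ => Fin (n + 1)) y h)

theorem played_cons_zero
    (a : (t : Fin (T + 1)) → (Fin (t : ℕ) → Fin (n + 1)) → Equiv.Perm (Fin m))
    (r : Fin (T + 1) → Relevance m n) : played a r 0 = a 0 Fin.elim0 := by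
  rw [played]
  congr 1
  exact funext fun s => s.elim0

/-- The one-step recursion behind induction on the horizon: after the first round, the play is that
of another deterministic strategy. -/
theorem played_succ (a : (t : Fin (T + 1)) → (Fin (t : ℕ) → Fin (n + 1)) → Equiv.Perm (Fin m))
    (r₀ : Relevance m n) (r : Fin T → Relevance m n) (t : Fin T) :
    played a (Fin.cons r₀ r) t.succ =
      played (tailStrategy a (r₀ (topObject (a 0 Fin.elim0)))) r t := by
  obtain ⟨t, ht⟩ := t
  induction t using Nat.strong_induction_on with
  | _ t ih =>
  rw [played, played, tailStrategy]
  congr 1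
  funext s
  refine Fin.cases ?_ (fun s => ?_) s
  · rw [Fin.cons_zero]
    change feedback a (Fin.cons r₀ r) 0 = _
    rw [feedback_eq, played_cons_zero, Fin.cons_zero]
  · rw [Fin.cons_succ]
    have := ih s s.2 (s.2.trans ht)
    change feedback a (Fin.cons r₀ r) (Fin.succ ⟨s, s.2.trans ht⟩) = _
    rw [feedback_eq, feedback_eq, this, Fin.cons_succ]

end PlayLemmas

/-! ### A two-point Bayesian lower bound -/

section TwoPoint

variable {m n : ℕ} [NeZero m]

/-- The potential `u * v / (u + v)` lies below both weights, so in an uninformative round it prices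
the sum of the two losses. -/
theorem harmonic_le_left {u v : ℝ} (hu : 0 ≤ u) (hv : 0 ≤ v) : u * v / (u + v) ≤ u := by
  rcases (add_nonneg hu hv).eq_or_lt with h | h
  · rw [← h, div_zero]; exact hu
  · rw [div_le_iff₀ h]; nlinarith [sq_nonneg u]

theorem harmonic_le_quarter {u v : ℝ} (hu : 0 ≤ u) (hv : 0 ≤ v) :
    u * v / (u + v) ≤ (u + v) / 4 := by
  rcases (add_nonneg hu hv).eq_or_lt with h | h
  · rw [← h]; norm_num
  · rw [div_le_iff₀ h]; nlinarith [sq_nonneg (u - v)]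

/-- The loss of `u * v / (u + v)` under one observation of a coin of bias `p` or `q`. -/
theorem harmonic_sub_le {u v p q : ℝ} (hu : 0 ≤ u) (hv : 0 ≤ v) (hp : 0 < p) (hq : 0 < q)
    (hpq : p + q = 1) :
    u * v / (u + v) ≤ (u * p) * (v * q) / (u * p + v * q) + (u * q) * (v * p) / (u * q + v * p) +
      (p - q) ^ 2 / 4 * (u + v) := by
  rcases hu.eq_or_lt with rfl | hu
  · simp; positivity
  rcases hv.eq_or_lt with rfl | hv
  · simp; positivity
  have hA : 0 < u * p + v * q := by positivity
  have hB : 0 < u * q + v * p := by positivity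
  have hs : 0 < u + v := by positivity
  -- An exact formula for the loss. It remains to use `4 * u * v ≤ (u + v) ^ 2`, and that the
  -- product of the two updated masses is at least `u * v` because `p + q = 1`.
  have key : u * v / (u + v) = (u * p) * (v * q) / (u * p + v * q) +
      (u * q) * (v * p) / (u * q + v * p) +
      (u * v) ^ 2 * (p - q) ^ 2 / ((u + v) * ((u * p + v * q) * (u * q + v * p))) := by
    obtain rfl : q = 1 - p := by linarith
    field_simp
    ring
  rw [key]
  gcongr
  rw [div_le_iff₀ (by positivity)]
  have hAB : u * v ≤ (u * p + v * q) * (u * q + v * p) := by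
    have : (u * p + v * q) * (u * q + v * p) - u * v * (p + q) ^ 2 = p * q * (u - v) ^ 2 := by ring
    rw [hpq] at this
    nlinarith [mul_nonneg (mul_pos hp hq).le (sq_nonneg (u - v))]
  have hs2 : 4 * (u * v) ≤ (u + v) ^ 2 := by nlinarith [sq_nonneg (u - v)]
  have h1 : 4 * (u * v) * (u * v) ≤ (u + v) ^ 2 * ((u * p + v * q) * (u * q + v * p)) :=
    mul_le_mul hs2 hAB (by positivity) (by positivity)
  have h2 : 0 ≤ (p - q) ^ 2 := sq_nonneg _
  nlinarith [mul_le_mul_of_nonneg_left h1 h2]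

/-- The total of `D σ_t x_t`, averaged over outcomes `ρ x_t` with independent `x_t` of law `P`. -/
noncomputable def averageTotal (ρ : Bool → Relevance m n) (P : Bool → ℝ)
    (D : Equiv.Perm (Fin m) → Bool → ℝ) {T : ℕ}
    (a : (t : Fin T) → (Fin (t : ℕ) → Fin (n + 1)) → Equiv.Perm (Fin m)) : ℝ :=
  ∑ x : Fin T → Bool, (∏ s, P (x s)) * ∑ t, D (played a (fun s => ρ (x s)) t) (x t)

theorem sum_prod_eq_one {P : Bool → ℝ} (hP : ∑ b, P b = 1) (T : ℕ) :
    ∑ x : Fin T → Bool, ∏ s, P (x s) = 1 := by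
  have := Finset.prod_univ_sum (fun _ : Fin T => (Finset.univ : Finset Bool)) fun _ b => P b
  rw [Fintype.piFinset_univ] at this
  rw [← this, hP, Finset.prod_const_one]

/-- Condition on the first coin: the remaining coins are independent of it, and it affects the rest
only through the first feedback. -/
theorem averageTotal_succ (ρ : Bool → Relevance m n) {P : Bool → ℝ} (hP : ∑ b, P b = 1)
    (D : Equiv.Perm (Fin m) → Bool → ℝ) {T : ℕ}
    (a : (t : Fin (T + 1)) → (Fin (t : ℕ) → Fin (n + 1)) → Equiv.Perm (Fin m)) :
    averageTotal ρ P D a = ∑ b, P b * D (a 0 Fin.elim0) b +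
      ∑ b, P b * averageTotal ρ P D (tailStrategy a (ρ b (topObject (a 0 Fin.elim0)))) := by
  unfold averageTotal
  rw [← (Fin.consEquiv fun _ : Fin (T + 1) => Bool).sum_comp, Fintype.sum_prod_type,
    ← Finset.sum_add_distrib]
  refine Finset.sum_congr rfl fun b _ => ?_
  rw [← mul_add, ← mul_one (D _ b), ← sum_prod_eq_one hP T, Finset.mul_sum, ← Finset.sum_add_distrib,
    Finset.mul_sum]
  refine Finset.sum_congr rfl fun x _ => ?_
  have hρ : (fun s => ρ ((Fin.consEquiv fun _ : Fin (T + 1) => Bool) (b, x) s)) =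
      Fin.cons (ρ b) fun s => ρ (x s) := by
    funext s
    refine Fin.cases ?_ (fun s => ?_) s <;> simp [Fin.consEquiv]
  rw [hρ, Fin.prod_univ_succ, Fin.sum_univ_succ, played_cons_zero]
  simp only [played_succ]
  simp only [Fin.consEquiv, Equiv.coe_fn_mk, Fin.cons_zero, Fin.cons_succ]
  ring

/-- Two hypotheses about the coin with opposite biases: if only actions that lose `κ` reveal the
coin, and no action is good under both hypotheses, the weighted loss grows linearly. -/
theorem harmonic_le_averageTotal (ρ : Bool → Relevance m n) {P Q : Bool → ℝ}
    {D E : Equiv.Perm (Fin m) → Bool → ℝ} {p q Θ κ : ℝ} {N : ℕ} (hp : 0 < p) (hq : 0 < q)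
    (hpq : p + q = 1) (hPt : P true = p) (hPf : P false = q) (hQt : Q true = q)
    (hQf : Q false = p) (hΘ : 0 ≤ Θ)
    (hD : ∀ σ, 0 ≤ ∑ b, P b * D σ b) (hE : ∀ σ, 0 ≤ ∑ b, Q b * E σ b)
    (hDE : ∀ σ, Θ ≤ ∑ b, P b * D σ b + ∑ b, Q b * E σ b)
    (hexp : ∀ σ, ρ true (topObject σ) ≠ ρ false (topObject σ) →
      κ ≤ ∑ b, P b * D σ b ∧ κ ≤ ∑ b, Q b * E σ b)
    (hκ : Θ / 4 + N * Θ * ((p - q) ^ 2 / 4) ≤ κ) {T : ℕ} (hT : T ≤ N)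
    (a : (t : Fin T) → (Fin (t : ℕ) → Fin (n + 1)) → Equiv.Perm (Fin m)) {u v : ℝ}
    (hu : 0 ≤ u) (hv : 0 ≤ v) :
    T * Θ * (u * v / (u + v)) ≤ u * averageTotal ρ P D a + v * averageTotal ρ Q E a := by
  induction T generalizing u v with
  | zero => simp [averageTotal]
  | succ T ih =>
  have hP : ∑ b, P b = 1 := by simp [hPt, hPf, hpq]
  have hQ : ∑ b, Q b = 1 := by simp [hQt, hQf, add_comm q p, hpq]
  rw [averageTotal_succ ρ hP, averageTotal_succ ρ hQ]
  set σ := a 0 Fin.elim0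
  have h1 := hD σ
  have h2 := hE σ
  have h3 := hDE σ
  set d := ∑ b, P b * D σ b
  set e := ∑ b, Q b * E σ b
  simp only [Fintype.sum_bool, hPt, hPf, hQt, hQf]
  set ψ := u * v / (u + v) with hψ
  have hψ0 : 0 ≤ ψ := by positivity
  push_cast
  by_cases hσ : ρ true (topObject σ) = ρ false (topObject σ)
  -- Uninformative round: both coin values lead to the same continuation, the weights stay put, and
  -- `u * d + v * e ≥ ψ * (d + e) ≥ ψ * Θ`.
  · rw [hσ]
    have hi := ih (by omega) (tailStrategy a (ρ false (topObject σ))) hu hv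
    set x := averageTotal ρ P D (tailStrategy a (ρ false (topObject σ)))
    set y := averageTotal ρ Q E (tailStrategy a (ρ false (topObject σ)))
    have hψu : ψ ≤ u := harmonic_le_left hu hv
    have hψv : ψ ≤ v := by
      rw [hψ, mul_comm, add_comm]; exact harmonic_le_left hv hu
    have e1 : p * x + q * x = x := by rw [← add_mul, hpq, one_mul]
    have e2 : q * y + p * y = y := by rw [← add_mul, add_comm q p, hpq, one_mul]
    rw [e1, e2]
    nlinarith [mul_le_mul_of_nonneg_right hψu h1, mul_le_mul_of_nonneg_right hψv h2,
      mul_le_mul_of_nonneg_left h3 hψ0]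
  -- Informative round: the weights become `(u * p, v * q)` or `(u * q, v * p)`. The loss `κ * (u +
  -- v)` pays for the drop of the potential over all remaining rounds and for the share `Θ * ψ` of
  -- this round.
  · obtain ⟨h4, h5⟩ := hexp σ hσ
    have hi1 := ih (by omega) (tailStrategy a (ρ true (topObject σ)))
      (mul_nonneg hu hp.le) (mul_nonneg hv hq.le)
    have hi2 := ih (by omega) (tailStrategy a (ρ false (topObject σ)))
      (mul_nonneg hu hq.le) (mul_nonneg hv hp.le)
    have hloss := harmonic_sub_le hu hv hp hq hpq
    have hq4 : ψ ≤ (u + v) / 4 := harmonic_le_quarter hu hv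
    have hTN : (T : ℝ) ≤ N := by exact_mod_cast (Nat.le_succ T).trans hT
    have hTΘ : 0 ≤ T * Θ := by positivity
    have hs : 0 ≤ u + v := add_nonneg hu hv
    have hl := mul_le_mul_of_nonneg_left hloss hTΘ
    have hk : (T * Θ * ((p - q) ^ 2 / 4) + Θ / 4) * (u + v) ≤ κ * (u + v) := by
      refine mul_le_mul_of_nonneg_right (le_trans ?_ hκ) hs
      have : T * Θ * ((p - q) ^ 2 / 4) ≤ N * Θ * ((p - q) ^ 2 / 4) := by gcongr
      linarith
    have h6 := mul_le_mul_of_nonneg_left h4 hu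
    have h7 := mul_le_mul_of_nonneg_left h5 hv
    have h8 := mul_le_mul_of_nonneg_left hq4 hΘ
    nlinarith

end TwoPoint

/-! ### The lower bound -/

section LowerBound

theorem discount_add_le {i j : ℕ} (h : i ≠ j) :
    discount i + discount j ≤ discount 0 + discount 1 := by
  have hd := discount_strictAnti.antitone
  rcases Nat.lt_or_gt_of_ne h with h | h
  · linarith [hd (Nat.zero_le i), hd (show 1 ≤ j by omega)]
  · linarith [hd (Nat.zero_le j), hd (show 1 ≤ i by omega)]

theorem discount_add_le_of_pos {i j : ℕ} (h : i ≠ j) (hi : 0 < i) (hj : 0 < j) :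
    discount i + discount j ≤ discount 1 + discount 2 := by
  have hd := discount_strictAnti.antitone
  rcases Nat.lt_or_gt_of_ne h with h | h
  · linarith [hd (show 1 ≤ i by omega), hd (show 2 ≤ j by omega)]
  · linarith [hd (show 1 ≤ j by omega), hd (show 2 ≤ i by omega)]

theorem discount_add_add_le {i j k : ℕ} (hij : i ≠ j) (hik : i ≠ k) (hjk : j ≠ k) :
    discount i + discount j + discount k ≤ discount 0 + discount 1 + discount 2 := by
  have hd := discount_strictAnti.antitone
  by_cases hi : i = 0
  · subst hi
    linarith [discount_add_le_of_pos hjk (by omega) (by omega)]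
  by_cases hj : j = 0
  · subst hj
    linarith [discount_add_le_of_pos hik (by omega) (by omega)]
  linarith [discount_add_le_of_pos hij (by omega) (by omega), hd (Nat.zero_le k)]

/-- Object `0` (expected gain `1`) cannot be placed above objects `1`, `2` (expected gains `p`, `q`)
at a loss less than a constant. -/
theorem le_sub_of_rank_eq_zero {p q : ℝ} {i j k : ℕ} (hq : 1 / 4 ≤ q) (hqp : q ≤ p)
    (hpq : p + q = 1) (hij : i ≠ j) (hik : i ≠ k) (hjk : j ≠ k) (h : j = 0 ∨ k = 0) :
    1 / 12 ≤ discount 0 + p * discount 1 + q * discount 2 -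
      (discount i + p * discount j + q * discount k) := by
  have hd := discount_strictAnti.antitone
  have h1 := discount_one_mem.2
  have h2 : discount 2 ≤ discount 1 := hd (by norm_num)
  -- Rank `0` belongs to `j` or `k`, hence not to `i`. The loss is then at least `q * (1 - discount
  -- 1) ≥ 1 / 4 * (1 / 3)`.
  have hi : discount i ≤ discount 1 := hd (by omega)
  obtain rfl : q = 1 - p := by linarith
  rcases h with rfl | rfl
  · have h3 := discount_add_le_of_pos hik (by omega) (by omega)
    rw [discount_zero] at *
    nlinarith [mul_le_mul_of_nonneg_left hi (show 0 ≤ p by linarith),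
      mul_le_mul_of_nonneg_left h3 (show 0 ≤ 1 - p by linarith)]
  · have h3 := discount_add_le_of_pos hij (by omega) (by omega)
    rw [discount_zero] at *
    nlinarith [mul_le_mul_of_nonneg_left hi (show 0 ≤ 1 - p by linarith),
      mul_le_mul_of_nonneg_left h3 (show 0 ≤ p by linarith),
      mul_le_mul_of_nonneg_left h2 (show 0 ≤ p - (1 - p) by linarith)]

/-- Abel summation: `1 ≥ p ≥ q` expresses the sum through partial sums with weights `1 - p`, `p -
q`, `q`, and each partial sum is largest on the first ranks. -/
theorem discount_combination_le {p q : ℝ} {i j k : ℕ} (hp : p ≤ 1) (hq : 0 ≤ q) (hqp : q ≤ p)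
    (hij : i ≠ j) (hik : i ≠ k) (hjk : j ≠ k) :
    discount i + p * discount j + q * discount k ≤
      discount 0 + p * discount 1 + q * discount 2 := by
  have h1 := discount_strictAnti.antitone (Nat.zero_le i)
  have h2 := discount_add_le hij
  have h3 := discount_add_add_le hij hik hjk
  nlinarith [mul_le_mul_of_nonneg_left h1 (sub_nonneg.2 hp),
    mul_le_mul_of_nonneg_left h2 (sub_nonneg.2 hqp), mul_le_mul_of_nonneg_left h3 hq]

variable {m n : ℕ}

/-- Object `0` is relevant, and so is one of the objects `1` and `2`, according to a coin. -/
def coinOutcome (m n : ℕ) (b : Bool) : Relevance m n := fun i =>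
  if (i : ℕ) = 0 then 1 else if (i : ℕ) = 1 then (if b then 1 else 0)
  else if (i : ℕ) = 2 then (if b then 0 else 1) else 0

theorem dcg_coinOutcome (hn : 1 ≤ n) {o₀ o₁ o₂ : Fin m} (h₀ : (o₀ : ℕ) = 0) (h₁ : (o₁ : ℕ) = 1)
    (h₂ : (o₂ : ℕ) = 2) (σ : Equiv.Perm (Fin m)) (b : Bool) :
    dcg σ (coinOutcome m n b) =
      discount (σ o₀) + if b then discount (σ o₁) else discount (σ o₂) := by
  obtain ⟨n, rfl⟩ : ∃ k, n = k + 1 := ⟨n - 1, by omega⟩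
  rw [dcg_eq, Finset.sum_eq_add o₀ (if b then o₁ else o₂)]
  · cases b <;> simp [coinOutcome, h₀, h₁, h₂] <;> norm_num
  · intro h
    have := congrArg Fin.val h
    cases b <;> simp [h₀, h₁, h₂] at this
  · rintro c - ⟨hc, hc'⟩
    have : (coinOutcome m (n + 1) b c : ℕ) = 0 := by
      have hc0 : (c : ℕ) ≠ 0 := fun h => hc (Fin.ext (h.trans h₀.symm))
      cases b
      · have hc2 : (c : ℕ) ≠ 2 := fun h => hc' (Fin.ext (h.trans h₂.symm))
        simp [coinOutcome, hc0, hc2]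
      · have hc1 : (c : ℕ) ≠ 1 := fun h => hc' (Fin.ext (h.trans h₁.symm))
        simp [coinOutcome, hc0, hc1]
    simp [this]
  · simp
  · simp

/-- Averaging argument: the regret dominates that against the fixed comparator `β` or `γ`, and some
coin sequence does at least as badly as the average. The two laws have total mass `2`, whence `2 *
c`. -/
theorem exists_regret_ge_of_averageTotal [NeZero m] {T : ℕ} (L : Learner m n T)
    (gain : Equiv.Perm (Fin m) → Relevance m n → ℝ) (ρ : Bool → Relevance m n) {P Q : Bool → ℝ}
    (hP : ∑ b, P b = 1) (hQ : ∑ b, Q b = 1) (hP0 : ∀ b, 0 < P b) (hQ0 : ∀ b, 0 < Q b)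
    (β γ : Equiv.Perm (Fin m)) {c : ℝ}
    (hc : ∀ a : (t : Fin T) → (Fin (t : ℕ) → Fin (n + 1)) → Equiv.Perm (Fin m),
      2 * c ≤ averageTotal ρ P (fun σ b => gain β (ρ b) - gain σ (ρ b)) a +
        averageTotal ρ Q (fun σ b => gain γ (ρ b) - gain σ (ρ b)) a) :
    ∃ r : Fin T → Relevance m n, c ≤ regret L gain r := by
  let _ := L.mΩ
  have := L.prob
  have hint : ∀ (δ : Equiv.Perm (Fin m)) (x : Fin T → Bool), Integrable
      (fun ω => ∑ t, (gain δ (ρ (x t)) - gain (played (L.act ω) (fun s => ρ (x s)) t) (ρ (x t))))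
      L.μ := fun δ x => integrable_finsetSum _ fun t _ =>
    (integrable_const _).sub (integrable_played L _ t fun σ => gain σ (ρ (x t)))
  have hreg : ∀ (δ : Equiv.Perm (Fin m)) (x : Fin T → Bool),
      ∫ ω, ∑ t, (gain δ (ρ (x t)) - gain (played (L.act ω) (fun s => ρ (x s)) t) (ρ (x t))) ∂L.μ ≤
        regret L gain fun s => ρ (x s) := by
    intro δ x
    simp only [Finset.sum_sub_distrib]
    rw [integral_sub (integrable_const _) (integrable_finsetSum _ fun t _ =>
      integrable_played L _ t fun σ => gain σ (ρ (x t))), integral_const]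
    simp only [probReal_univ, one_smul, regret]
    exact sub_le_sub_right (Finset.le_sup' (fun σ => ∑ t, gain σ (ρ (x t))) (Finset.mem_univ δ)) _
  have havg : ∀ (R : Bool → ℝ) (δ : Equiv.Perm (Fin m)), (∀ b, 0 < R b) →
      Integrable (fun ω => averageTotal ρ R (fun σ b => gain δ (ρ b) - gain σ (ρ b)) (L.act ω))
        L.μ ∧
      ∫ ω, averageTotal ρ R (fun σ b => gain δ (ρ b) - gain σ (ρ b)) (L.act ω) ∂L.μ ≤
        ∑ x : Fin T → Bool, (∏ s, R (x s)) * regret L gain fun s => ρ (x s) := by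
    intro R δ hR
    have hi : ∀ x : Fin T → Bool, Integrable (fun ω => (∏ s, R (x s)) *
        ∑ t, (gain δ (ρ (x t)) - gain (played (L.act ω) (fun s => ρ (x s)) t) (ρ (x t)))) L.μ :=
      fun x => (hint δ x).const_mul _
    refine ⟨integrable_finsetSum _ fun x _ => hi x, ?_⟩
    unfold averageTotal
    rw [integral_finsetSum _ fun x _ => hi x]
    refine Finset.sum_le_sum fun x _ => ?_
    rw [integral_const_mul]
    exact mul_le_mul_of_nonneg_left (hreg δ x) (Finset.prod_nonneg fun s _ => (hR _).le)
  obtain ⟨hi1, h1⟩ := havg P β hP0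
  obtain ⟨hi2, h2⟩ := havg Q γ hQ0
  have h3 : 2 * c ≤ ∑ x : Fin T → Bool,
      (∏ s, P (x s) + ∏ s, Q (x s)) * regret L gain fun s => ρ (x s) := by
    simp only [add_mul, Finset.sum_add_distrib]
    refine le_trans ?_ (add_le_add h1 h2)
    rw [← integral_add hi1 hi2]
    have := integral_mono (integrable_const (2 * c)) (hi1.add hi2) fun ω => hc (L.act ω)
    simpa using this
  have h4 : ∑ x : Fin T → Bool, (∏ s, P (x s) + ∏ s, Q (x s)) * c ≤ ∑ x : Fin T → Bool,
      (∏ s, P (x s) + ∏ s, Q (x s)) * regret L gain fun s => ρ (x s) := by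
    rw [← Finset.sum_mul, Finset.sum_add_distrib, sum_prod_eq_one hP, sum_prod_eq_one hQ]
    linarith
  obtain ⟨x, -, hx⟩ := Finset.exists_le_of_sum_le Finset.univ_nonempty h4
  exact ⟨_, le_of_mul_le_mul_left hx (add_pos (Finset.prod_pos fun s _ => hP0 _)
    (Finset.prod_pos fun s _ => hQ0 _))⟩

theorem exists_regret_ge [NeZero m] (hm : 3 ≤ m) (hn : 1 ≤ n) {T : ℕ} (L : Learner m n T) :
    ∃ r : Fin T → Relevance m n, 1 / 64 * (T : ℝ) ^ (2 / 3 : ℝ) ≤ regret L dcg r := by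
  set o₀ : Fin m := ⟨0, by omega⟩ with ho₀
  set o₁ : Fin m := ⟨1, by omega⟩ with ho₁
  set o₂ : Fin m := ⟨2, by omega⟩ with ho₂
  have hdcg := dcg_coinOutcome (m := m) (n := n) (o₀ := o₀) (o₁ := o₁) (o₂ := o₂) hn rfl rfl rfl
  -- Bounding `T * δ ^ 3` keeps the value of information below the exploration loss, while `T * δ`
  -- has the order of the claimed regret. For `T = 0` the real power is `0`, so `δ = 0`.
  set δ : ℝ := 1 / 4 * (T : ℝ) ^ (-(1 / 3) : ℝ) with hδ
  have hδ0 : 0 ≤ δ := by positivity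
  have hTδ : T * δ ^ 3 ≤ 1 / 64 ∧ T * δ = 1 / 4 * (T : ℝ) ^ (2 / 3 : ℝ) ∧ δ ≤ 1 / 4 := by
    rcases T.eq_zero_or_pos with rfl | hT
    · norm_num [hδ]
    have hT' : (0 : ℝ) < T := by exact_mod_cast hT
    have h1 : ((T : ℝ) ^ (-(1 / 3) : ℝ)) ^ 3 = (T : ℝ)⁻¹ := by
      rw [← Real.rpow_natCast, ← Real.rpow_mul hT'.le, ← Real.rpow_neg_one]
      norm_num
    have h2 : (T : ℝ) * (T : ℝ) ^ (-(1 / 3) : ℝ) = (T : ℝ) ^ (2 / 3 : ℝ) := by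
      nth_rewrite 1 [← Real.rpow_one (T : ℝ)]
      rw [← Real.rpow_add hT']
      norm_num
    have h3 : (T : ℝ) ^ (-(1 / 3) : ℝ) ≤ 1 :=
      Real.rpow_le_one_of_one_le_of_nonpos (by exact_mod_cast hT) (by norm_num)
    refine ⟨?_, ?_, ?_⟩
    · rw [hδ, mul_pow, h1]
      field_simp
      norm_num
    · rw [hδ, ← h2]; ring
    · rw [hδ]; linarith
  obtain ⟨hT3, hT1, hδ4⟩ := hTδ
  set p : ℝ := 1 / 2 + δ with hp
  set q : ℝ := 1 / 2 - δ with hq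
  have hd1 := discount_one_mem
  have hd2 := discount_two
  have hne : ∀ σ : Equiv.Perm (Fin m), (σ o₀ : ℕ) ≠ σ o₁ ∧ (σ o₀ : ℕ) ≠ σ o₂ ∧
      (σ o₁ : ℕ) ≠ σ o₂ := by
    intro σ
    refine ⟨?_, ?_, ?_⟩ <;>
    · intro h
      have := σ.injective (Fin.ext h)
      simp [ho₀, ho₁, ho₂] at this
  have hsw1 : Equiv.swap o₁ o₂ o₀ = o₀ := Equiv.swap_apply_of_ne_of_ne (by simp [ho₀, ho₁])
    (by simp [ho₀, ho₂])
  have hdcg1 : ∀ b, dcg (1 : Equiv.Perm (Fin m)) (coinOutcome m n b) =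
      discount 0 + if b then discount 1 else discount 2 := fun b => hdcg 1 b
  have hdcg2 : ∀ b, dcg (Equiv.swap o₁ o₂) (coinOutcome m n b) =
      discount 0 + if b then discount 2 else discount 1 := by
    intro b
    rw [hdcg, hsw1, Equiv.swap_apply_left, Equiv.swap_apply_right]
  refine exists_regret_ge_of_averageTotal L dcg (coinOutcome m n)
    (P := fun b => if b then p else q) (Q := fun b => if b then q else p)
    (by simp [hp, hq]; ring) (by simp [hp, hq]; ring)
    (by rintro (_ | _) <;> simp [hp, hq] <;> linarith)
    (by rintro (_ | _) <;> simp [hp, hq] <;> linarith) 1 (Equiv.swap o₁ o₂) fun a => ?_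
  -- `Θ` is the least sum of a ranking's losses under the two biases, reached by the identity; `κ`
  -- is the loss of `le_sub_of_rank_eq_zero`.
  have key := harmonic_le_averageTotal (coinOutcome m n)
    (P := fun b => if b then p else q) (Q := fun b => if b then q else p)
    (D := fun σ b => dcg 1 (coinOutcome m n b) - dcg σ (coinOutcome m n b))
    (E := fun σ b => dcg (Equiv.swap o₁ o₂) (coinOutcome m n b) - dcg σ (coinOutcome m n b))
    (p := p) (q := q) (Θ := 2 * (discount 1 - discount 2) * δ) (κ := 1 / 12) (N := T)
    (by linarith) (by linarith) (by linarith) rfl rfl rfl rfl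
    (mul_nonneg (by linarith [hd1.1]) hδ0) ?_ ?_ ?_ ?_ ?_ le_rfl a zero_le_one zero_le_one
  -- `discount 1 - discount 2 ≥ 1 / 8`, and the potential starts at `1 / 2`; the result is `2 * (1 /
  -- 64)` times `T ^ (2/3)`.
  · have h1 : 1 / 8 * (T * δ) ≤ T * (2 * (discount 1 - discount 2) * δ) * (1 * 1 / (1 + 1)) := by
      have : 0 ≤ T * δ := by positivity
      nlinarith [hd1.1]
    rw [hT1] at h1
    linarith
  · intro σ
    obtain ⟨h01, h02, h12⟩ := hne σ
    have := discount_combination_le (p := p) (q := q) (by linarith) (by linarith) (by linarith)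
      h01 h02 h12
    simp only [hdcg1, hdcg, Fintype.sum_bool, if_true, Bool.false_eq_true, if_false]
    linear_combination this + (discount 0 - discount (σ o₀)) * (by linarith : p + q = 1)
  · intro σ
    obtain ⟨h01, h02, h12⟩ := hne σ
    have := discount_combination_le (p := p) (q := q) (by linarith) (by linarith) (by linarith)
      h02 h01 h12.symm
    simp only [hdcg2, hdcg, Fintype.sum_bool, if_true, Bool.false_eq_true, if_false]
    linear_combination this + (discount 0 - discount (σ o₀)) * (by linarith : p + q = 1)
  · intro σ
    obtain ⟨h01, h02, h12⟩ := hne σ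
    have h1 := discount_strictAnti.antitone (Nat.zero_le (σ o₀))
    have h2 := discount_add_add_le h01 h02 h12
    simp only [hdcg1, hdcg2, hdcg, Fintype.sum_bool, if_true, Bool.false_eq_true, if_false]
    rw [hp, hq]
    linarith
  · intro σ hσ
    obtain ⟨h01, h02, h12⟩ := hne σ
    have htop : topObject σ = o₁ ∨ topObject σ = o₂ := by
      by_contra! h
      refine hσ ?_
      simp only [ne_eq, Fin.ext_iff, ho₁, ho₂] at h
      simp [coinOutcome, h.1, h.2]
    have h0 : (σ o₁ : ℕ) = 0 ∨ (σ o₂ : ℕ) = 0 := by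
      refine htop.imp (fun h => ?_) fun h => ?_ <;> rw [← h, topObject, Equiv.apply_symm_apply] <;>
        rfl
    have h1 := le_sub_of_rank_eq_zero (p := p) (q := q) (by linarith) (by linarith) (by linarith)
      h01 h02 h12 h0
    have h2 := le_sub_of_rank_eq_zero (p := p) (q := q) (by linarith) (by linarith) (by linarith)
      h02 h01 h12.symm h0.symm
    simp only [hdcg1, hdcg2, hdcg, Fintype.sum_bool, if_true, Bool.false_eq_true, if_false]
    constructor
    · linear_combination h1 + (discount 0 - discount (σ o₀)) * (by linarith : p + q = 1)
    · linear_combination h2 + (discount 0 - discount (σ o₀)) * (by linarith : p + q = 1)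
  -- Here `Θ ≤ δ / 3`, so the left side is at most `δ / 12 + T * δ ^ 3 / 3 ≤ 1 / 48 + 1 / 192`.
  · have h1 : p - q = 2 * δ := by rw [hp, hq]; ring
    rw [h1]
    have h2 : 2 * (discount 1 - discount 2) ≤ 1 / 3 := by linarith [hd1.2]
    have h3 : (0 : ℝ) ≤ T * δ ^ 3 := by positivity
    nlinarith [mul_le_mul_of_nonneg_right h2 h3, mul_le_mul_of_nonneg_right h2 hδ0]

end LowerBound

/-! ### Follow the perturbed leader with a uniform perturbation -/

section Perturbation

variable {m : ℕ}

/-- The uniform distribution on the cube `[0, 1 / ε] ^ m`. -/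
noncomputable def perturbation (m : ℕ) (ε : ℝ) : Measure (Fin m → ℝ) :=
  Measure.pi fun _ : Fin m => cond volume (Set.Icc (0 : ℝ) (1 / ε))

theorem isProbabilityMeasure_cond_Icc {ε : ℝ} (hε : 0 < ε) :
    IsProbabilityMeasure (cond (volume : Measure ℝ) (Set.Icc (0 : ℝ) (1 / ε))) := by
  refine cond_isProbabilityMeasure_of_finite ?_ ?_
  · simp [Real.volume_Icc, hε]
  · simp [Real.volume_Icc]

theorem isProbabilityMeasure_perturbation {ε : ℝ} (hε : 0 < ε) :
    IsProbabilityMeasure (perturbation m ε) := by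
  have := isProbabilityMeasure_cond_Icc hε
  unfold perturbation
  infer_instance

theorem perturbation_eq_cond {ε : ℝ} (hε : 0 < ε) :
    perturbation m ε = cond volume (Set.univ.pi fun _ : Fin m => Set.Icc (0 : ℝ) (1 / ε)) := by
  have := isProbabilityMeasure_cond_Icc hε
  have hI : MeasurableSet (Set.univ.pi fun _ : Fin m => Set.Icc (0 : ℝ) (1 / ε)) :=
    MeasurableSet.univ_pi fun _ => measurableSet_Icc
  refine Measure.pi_eq fun s hs => ?_
  rw [cond_apply hI, ← Set.pi_inter_distrib, volume_pi_pi, volume_pi_pi]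
  simp only [cond_apply measurableSet_Icc, Finset.prod_mul_distrib]
  congr 1
  refine ENNReal.prod_inv_distrib ?_
  intro i _ j _ _
  left
  simp [Real.volume_Icc, hε]

theorem ae_mem_Icc_perturbation {ε : ℝ} (hε : 0 < ε) :
    ∀ᵐ q ∂perturbation m ε, ∀ i, q i ∈ Set.Icc (0 : ℝ) (1 / ε) := by
  have hI : MeasurableSet (Set.univ.pi fun _ : Fin m => Set.Icc (0 : ℝ) (1 / ε)) :=
    MeasurableSet.univ_pi fun _ => measurableSet_Icc
  rw [perturbation_eq_cond hε]
  filter_upwards [ae_cond_mem hI] with q hq i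
  exact hq i trivial

/-- Union bound: coordinate `i` leaves the interval only from its top piece of length `v i`, and the
density is `ε`. -/
theorem perturbation_real_shift_le {ε : ℝ} (hε : 0 < ε) {v : Fin m → ℝ} (hv : ∀ i, 0 ≤ v i) :
    (perturbation m ε).real {q | ¬ ∀ i, q i + v i ∈ Set.Icc (0 : ℝ) (1 / ε)} ≤ ε * ∑ i, v i := by
  have := isProbabilityMeasure_cond_Icc hε
  have := isProbabilityMeasure_perturbation (m := m) hε
  have hset : {q : Fin m → ℝ | ¬ ∀ i, q i + v i ∈ Set.Icc (0 : ℝ) (1 / ε)} =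
      ⋃ i ∈ Finset.univ, {q | q i + v i ∉ Set.Icc (0 : ℝ) (1 / ε)} := by
    ext q; simp
  rw [hset, Finset.mul_sum]
  refine (measureReal_biUnion_finset_le _ _).trans (Finset.sum_le_sum fun i _ => ?_)
  have hms : MeasurableSet {x : ℝ | x + v i ∉ Set.Icc (0 : ℝ) (1 / ε)} :=
    (measurableSet_Icc.preimage (measurable_add_const (v i))).compl
  have h1 : (perturbation m ε) {q | q i + v i ∉ Set.Icc (0 : ℝ) (1 / ε)} =
      cond volume (Set.Icc (0 : ℝ) (1 / ε)) {x : ℝ | x + v i ∉ Set.Icc (0 : ℝ) (1 / ε)} :=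
    (measurePreserving_eval (fun _ : Fin m => cond volume (Set.Icc (0 : ℝ) (1 / ε)))
      i).measure_preimage hms.nullMeasurableSet
  have h2 : Set.Icc (0 : ℝ) (1 / ε) ∩ {x : ℝ | x + v i ∉ Set.Icc (0 : ℝ) (1 / ε)} ⊆
      Set.Ioc (1 / ε - v i) (1 / ε) := by
    rintro x ⟨⟨hx1, hx2⟩, hx3⟩
    refine ⟨?_, hx2⟩
    by_contra hle
    exact hx3 ⟨by linarith [hv i], by linarith⟩
  rw [Measure.real, h1, cond_apply measurableSet_Icc, Real.volume_Icc, sub_zero,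
    ENNReal.toReal_mul, ENNReal.toReal_inv, ENNReal.toReal_ofReal (by positivity), one_div, inv_inv]
  rw [one_div] at h2
  refine mul_le_mul_of_nonneg_left ?_ hε.le
  refine ENNReal.toReal_le_of_le_ofReal (hv i) ((measure_mono h2).trans ?_)
  rw [Real.volume_Ioc, sub_sub_cancel]

/-- Translating the perturbation changes the expectation of a bounded function only a little. -/
theorem integral_perturbation_add_le {ε R : ℝ} (hε : 0 < ε) {h : (Fin m → ℝ) → ℝ}
    (hm : Measurable h) (h0 : ∀ q, 0 ≤ h q) (hR : ∀ q, h q ≤ R) {v : Fin m → ℝ}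
    (hv : ∀ i, 0 ≤ v i) :
    ∫ q, h (q + v) ∂perturbation m ε ≤
      ∫ q, h q ∂perturbation m ε + R * (ε * ∑ i, v i) := by
  have := isProbabilityMeasure_perturbation (m := m) hε
  set I : Set (Fin m → ℝ) := Set.univ.pi fun _ : Fin m => Set.Icc (0 : ℝ) (1 / ε) with hI
  have hIm : MeasurableSet I := MeasurableSet.univ_pi fun _ => measurableSet_Icc
  have hbad : MeasurableSet {q : Fin m → ℝ | q + v ∉ I} :=
    (hIm.preimage (measurable_add_const v)).compl
  have hbadR : (perturbation m ε).real {q : Fin m → ℝ | q + v ∉ I} ≤ ε * ∑ i, v i := by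
    have : {q : Fin m → ℝ | q + v ∉ I} = {q | ¬ ∀ i, q i + v i ∈ Set.Icc (0 : ℝ) (1 / ε)} := by
      ext q; simp only [hI, Set.mem_ofPred_eq, Set.mem_pi, Set.mem_univ, true_imp_iff, Pi.add_apply]
    rw [this]
    exact perturbation_real_shift_le hε hv
  have hbdd : ∀ q, ‖I.indicator h q‖ ≤ R := by
    intro q
    rw [Real.norm_eq_abs, abs_of_nonneg (Set.indicator_nonneg (fun q _ => h0 q) q)]
    exact Set.indicator_le' (fun q _ => hR q) (fun q _ => (h0 q).trans (hR q)) q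
  have hR0 : 0 ≤ R := (h0 0).trans (hR 0)
  have hind : Measurable (I.indicator h) := hm.indicator hIm
  have hi1 : Integrable (fun q => I.indicator h (q + v)) (perturbation m ε) :=
    Integrable.of_bound (hind.comp (measurable_add_const v)).aestronglyMeasurable R
      (Filter.Eventually.of_forall fun q => hbdd _)
  have hi2 : Integrable (fun q => {q : Fin m → ℝ | q + v ∉ I}.indicator (fun _ => R) q)
      (perturbation m ε) := (integrable_const R).indicator hbad
  -- Outside the event `q + v ∈ I` the integrand is bounded by `R`; inside it, translation
  -- invariance of Lebesgue measure applies.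
  have h1 : ∫ q, h (q + v) ∂perturbation m ε ≤ ∫ q, I.indicator h (q + v) ∂perturbation m ε +
      ∫ q, {q : Fin m → ℝ | q + v ∉ I}.indicator (fun _ => R) q ∂perturbation m ε := by
    rw [← integral_add hi1 hi2]
    refine integral_mono (Integrable.of_bound
      (hm.comp (measurable_add_const v)).aestronglyMeasurable R
      (Filter.Eventually.of_forall fun q => ?_)) (hi1.add hi2) fun q => ?_
    · rw [Real.norm_eq_abs, abs_of_nonneg (h0 _)]; exact hR _
    · by_cases hq : q + v ∈ I
      · simp [Set.indicator, hq]
      · simp [Set.indicator, hq, hR]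
  have h2 : ∫ q, {q : Fin m → ℝ | q + v ∉ I}.indicator (fun _ => R) q ∂perturbation m ε ≤
      R * (ε * ∑ i, v i) := by
    rw [integral_indicator_const _ hbad, smul_eq_mul, mul_comm]
    exact mul_le_mul_of_nonneg_left hbadR hR0
  have h3 : ∫ q, I.indicator h (q + v) ∂perturbation m ε ≤ ∫ q, h q ∂perturbation m ε := by
    have hIfin : volume I ≠ ⊤ := by
      rw [hI, volume_pi_pi]
      exact ENNReal.prod_ne_top fun i _ => by simp [Real.volume_Icc]
    rw [perturbation_eq_cond hε, ← hI, ProbabilityTheory.cond, integral_smul_measure,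
      integral_smul_measure]
    refine smul_le_smul_of_nonneg_left ?_ ENNReal.toReal_nonneg
    have hint : Integrable (I.indicator h) := by
      rw [integrable_indicator_iff hIm]
      exact Measure.integrableOn_of_bounded hIfin hm.aestronglyMeasurable (M := R)
        (Filter.Eventually.of_forall fun q => by
          rw [Real.norm_eq_abs, abs_of_nonneg (h0 _)]; exact hR _)
    refine (setIntegral_le_integral (hint.comp_add_right v) (Filter.Eventually.of_forall fun q =>
      Set.indicator_nonneg (fun q _ => h0 q) _)).trans ?_
    rw [integral_add_right_eq_self (I.indicator h) v, integral_indicator hIm]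
  linarith

/-- A minimizer of the rank-weighted sum of the scores orders the objects by decreasing score. -/
theorem ArgminRule.le_of_lt (M : ArgminRule m) {y : Fin m → ℝ} {i j : Fin m}
    (h : M.toFun y i < M.toFun y j) : y j ≤ y i := by
  have h1 := M.isArgmin y ((Equiv.swap i j).trans (M.toFun y))
  have h2 := sum_swap_mul (fun x => (rank (M.toFun y) x : ℝ)) y i j
  have h3 : ∑ x, (rank ((Equiv.swap i j).trans (M.toFun y)) x : ℝ) * y x =
      ∑ x, (rank (M.toFun y) (Equiv.swap i j x) : ℝ) * y x := rfl
  rw [h3, h2] at h1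
  have h4 : (rank (M.toFun y) i : ℝ) < rank (M.toFun y) j := by
    have : (M.toFun y i : ℕ) < M.toFun y j := h
    unfold rank
    exact_mod_cast Nat.succ_lt_succ this
  by_contra! hlt
  nlinarith

theorem ArgminRule.sum_discount_mul_le (M : ArgminRule m) (y : Fin m → ℝ)
    (σ : Equiv.Perm (Fin m)) :
    ∑ i, discount (σ i) * y i ≤ ∑ i, discount (M.toFun y i) * y i :=
  TopOne.sum_discount_mul_le (fun _ _ h => M.le_of_lt h) σ

theorem ArgminRule.measurable_comp (M : ArgminRule m) (F : Equiv.Perm (Fin m) → ℝ) :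
    Measurable fun y => F (M.toFun y) := by
  let _ : MeasurableSpace (Equiv.Perm (Fin m)) := ⊤
  exact (measurable_from_top (f := F)).comp (measurable_to_countable' fun σ => M.measurable σ)

theorem ArgminRule.integrable_comp {Ω : Type*} [MeasurableSpace Ω] {μ : Measure Ω}
    [IsFiniteMeasure μ] (M : ArgminRule m) (F : Equiv.Perm (Fin m) → ℝ) {f : Ω → Fin m → ℝ}
    (hf : Measurable f) : Integrable (fun ω => F (M.toFun (f ω))) μ :=
  Integrable.of_bound ((M.measurable_comp F).comp hf).aestronglyMeasurable (∑ σ, |F σ|)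
    (Filter.Eventually.of_forall fun _ => Finset.single_le_sum (f := fun σ => |F σ|)
      (fun _ _ => abs_nonneg _) (Finset.mem_univ _))

/-- The expected discount of object `i` when the ranking follows the perturbed scores. -/
noncomputable def meanDiscount (M : ArgminRule m) (ε : ℝ) (y : Fin m → ℝ) (i : Fin m) : ℝ :=
  ∫ q, discount (M.toFun (y + q) i) ∂perturbation m ε

theorem meanDiscount_nonneg (M : ArgminRule m) (ε : ℝ) (y : Fin m → ℝ) (i : Fin m) :
    0 ≤ meanDiscount M ε y i := integral_nonneg fun _ => (discount_pos _).le

theorem sum_meanDiscount_mul (M : ArgminRule m) {ε : ℝ} (hε : 0 < ε) (y z : Fin m → ℝ) :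
    ∑ i, meanDiscount M ε y i * z i =
      ∫ q, ∑ i, discount (M.toFun (y + q) i) * z i ∂perturbation m ε := by
  have := isProbabilityMeasure_perturbation (m := m) hε
  rw [integral_finsetSum _ fun i _ => (M.integrable_comp (fun σ => discount (σ i))
    (measurable_const_add y)).mul_const (z i)]
  exact Finset.sum_congr rfl fun i _ => (integral_mul_const _ _).symm

theorem sum_discount_mul_mem {z : Fin m → ℝ} {G : ℝ} (h0 : ∀ i, 0 ≤ z i) (hG : ∀ i, z i ≤ G)
    (σ : Equiv.Perm (Fin m)) : ∑ i, discount (σ i) * z i ∈ Set.Icc 0 (m * G) := by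
  refine ⟨Finset.sum_nonneg fun i _ => mul_nonneg (discount_pos _).le (h0 i), ?_⟩
  calc ∑ i, discount (σ i) * z i ≤ ∑ _i : Fin m, G := Finset.sum_le_sum fun i _ =>
        (mul_le_of_le_one_left (h0 i) (discount_le_one _)).trans (hG i)
    _ = m * G := by simp

/-- Following the leader of the next step is at least as good as the final leader, up to the
contribution of the perturbation. -/
theorem be_the_leader (M : ArgminRule m) (Z : ℕ → Fin m → ℝ) (hZ : Z 0 = 0) (q : Fin m → ℝ)
    (K : ℕ) :
    ∑ i, discount (M.toFun (Z K + q) i) * (Z K + q) i ≤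
      ∑ k ∈ Finset.range K, ∑ i, discount (M.toFun (Z (k + 1) + q) i) * (Z (k + 1) i - Z k i) +
        ∑ i, discount (M.toFun q i) * q i := by
  induction K with
  | zero => simp [hZ]
  | succ K ih =>
  rw [Finset.sum_range_succ]
  have h1 := M.sum_discount_mul_le (Z K + q) (M.toFun (Z (K + 1) + q))
  have h2 : ∑ i, discount (M.toFun (Z (K + 1) + q) i) * (Z (K + 1) + q) i =
      ∑ i, discount (M.toFun (Z (K + 1) + q) i) * (Z K + q) i +
        ∑ i, discount (M.toFun (Z (K + 1) + q) i) * (Z (K + 1) i - Z K i) := by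
    rw [← Finset.sum_add_distrib]
    exact Finset.sum_congr rfl fun i _ => by simp only [Pi.add_apply]; ring
  linarith

/-- Seeing one step ahead equals translating the perturbation by the increment, which costs at most
`ε * (m * G) ^ 2` per step; the perturbation itself contributes at most `m / ε`. Only expectations
at each step enter, so one `q` shared by all steps suffices although the algorithm redraws it. -/
theorem follow_perturbed_leader (M : ArgminRule m) {ε G : ℝ} (hε : 0 < ε) {Z : ℕ → Fin m → ℝ}
    (hZ : Z 0 = 0) {K : ℕ} (h0 : ∀ k < K, ∀ i, 0 ≤ Z (k + 1) i - Z k i)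
    (hG : ∀ k < K, ∀ i, Z (k + 1) i - Z k i ≤ G) (σ : Equiv.Perm (Fin m)) :
    ∑ i, discount (σ i) * Z K i ≤
      ∑ k ∈ Finset.range K, ∑ i, meanDiscount M ε (Z k) i * (Z (k + 1) i - Z k i) +
        (m / ε + ε * K * (m * G) ^ 2) := by
  have := isProbabilityMeasure_perturbation (m := m) hε
  have hstep : ∀ k ∈ Finset.range K,
      ∑ i, meanDiscount M ε (Z (k + 1)) i * (Z (k + 1) i - Z k i) ≤
        ∑ i, meanDiscount M ε (Z k) i * (Z (k + 1) i - Z k i) + ε * (m * G) ^ 2 := by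
    intro k hk
    have hk' := Finset.mem_range.1 hk
    rw [sum_meanDiscount_mul M hε, sum_meanDiscount_mul M hε]
    have hb := fun q => sum_discount_mul_mem (h0 k hk') (hG k hk') (M.toFun (Z k + q))
    have h1 := integral_perturbation_add_le (R := m * G) hε
      (h := fun q => ∑ i, discount (M.toFun (Z k + q) i) * (Z (k + 1) i - Z k i))
      ((M.measurable_comp fun σ => ∑ i, discount (σ i) * (Z (k + 1) i - Z k i)).comp
        (measurable_const_add (Z k))) (fun q => (hb q).1) (fun q => (hb q).2)
      (v := fun i => Z (k + 1) i - Z k i) (h0 k hk')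
    have h2 : ∀ q, Z k + (q + fun i => Z (k + 1) i - Z k i) = Z (k + 1) + q := by
      intro q; ext i; simp only [Pi.add_apply]; ring
    simp only [h2] at h1
    refine h1.trans (add_le_add le_rfl ?_)
    have h3 : ∑ i, (Z (k + 1) i - Z k i) ≤ m * G := by
      calc _ ≤ ∑ _i : Fin m, G := Finset.sum_le_sum fun i _ => hG k hk' i
        _ = m * G := by simp
    have h4 : 0 ≤ m * G := (hb 0).1.trans (hb 0).2
    calc m * G * (ε * ∑ i, (Z (k + 1) i - Z k i)) ≤ m * G * (ε * (m * G)) := by gcongr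
      _ = ε * (m * G) ^ 2 := by ring
  have hint : ∀ k, Integrable (fun q => ∑ i, discount (M.toFun (Z (k + 1) + q) i) *
      (Z (k + 1) i - Z k i)) (perturbation m ε) := fun k =>
    M.integrable_comp (fun σ => ∑ i, discount (σ i) * (Z (k + 1) i - Z k i))
      (measurable_const_add _)
  have hbtl : ∑ i, discount (σ i) * Z K i ≤
      ∑ k ∈ Finset.range K, ∑ i, meanDiscount M ε (Z (k + 1)) i * (Z (k + 1) i - Z k i) +
        m / ε := by
    simp only [sum_meanDiscount_mul M hε]
    rw [← integral_finsetSum _ fun k _ => hint k]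
    have hae : ∀ᵐ q ∂perturbation m ε, ∑ i, discount (σ i) * Z K i - m / ε ≤
        ∑ k ∈ Finset.range K, ∑ i, discount (M.toFun (Z (k + 1) + q) i) *
          (Z (k + 1) i - Z k i) := by
      filter_upwards [ae_mem_Icc_perturbation hε] with q hq
      have h1 := be_the_leader M Z hZ q K
      have h2 := M.sum_discount_mul_le (Z K + q) σ
      have h3 := (sum_discount_mul_mem (fun i => (hq i).1) (fun i => (hq i).2) (M.toFun q)).2
      have h4 : ∑ i, discount (σ i) * Z K i ≤ ∑ i, discount (σ i) * (Z K + q) i :=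
        Finset.sum_le_sum fun i _ => mul_le_mul_of_nonneg_left
          (by simpa using (hq i).1) (discount_pos _).le
      rw [mul_one_div] at h3
      linarith
    have h5 := integral_mono_ae (integrable_const _)
      (integrable_finsetSum (Finset.range K) fun k _ => hint k) hae
    rw [integral_const, probReal_univ, one_smul] at h5
    linarith
  have h6 := Finset.sum_le_sum hstep
  rw [Finset.sum_add_distrib, Finset.sum_const, Finset.card_range, nsmul_eq_mul] at h6
  linarith

end Perturbation

/-! ### Exploration rounds -/

section Exploration

variable {m n T K : ℕ}

theorem exploreRound_lt_horizon (τ : Fin K → Fin m → Fin (T / K)) (k : Fin K) (j : Fin m) :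
    exploreRound τ k j < T := by
  have h1 : ((k : ℕ) + 1) * (T / K) ≤ K * (T / K) := Nat.mul_le_mul_right _ k.2
  have h2 := Nat.mul_div_le T K
  have h3 := (τ k j).2
  have h4 : ((k : ℕ) + 1) * (T / K) = (k : ℕ) * (T / K) + T / K := by ring
  unfold exploreRound
  omega

theorem exploreRound_div (τ : Fin K → Fin m → Fin (T / K)) (k : Fin K) (j : Fin m) :
    exploreRound τ k j / (T / K) = k := by
  have h3 := (τ k j).2
  unfold exploreRound
  rw [mul_comm, Nat.mul_add_div (by omega), Nat.div_eq_of_lt h3, add_zero]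

/-- Makes the object chosen in `rtop1fAct` unambiguous: the round determines the block, and
injectivity then determines the object. -/
theorem eq_of_exploreRound_eq {τ : Fin K → Fin m → Fin (T / K)}
    (hτ : ∀ k, Function.Injective (τ k)) {k k' : Fin K} {j j' : Fin m}
    (h : exploreRound τ k j = exploreRound τ k' j') : j = j' := by
  have hk : k = k' := Fin.ext (by rw [← exploreRound_div τ k j, h, exploreRound_div])
  subst hk
  exact hτ k (Fin.ext (by simpa [exploreRound] using h))

/-- The law of the exploration positions of all blocks. -/
noncomputable def exploration (m T K : ℕ) : Measure (Fin K → Fin m → Fin (T / K)) :=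
  Measure.pi fun _ : Fin K => uniformOn {f : Fin m → Fin (T / K) | Function.Injective f}

theorem isProbabilityMeasure_uniformOn_injective (hB : m ≤ T / K) :
    IsProbabilityMeasure (uniformOn {f : Fin m → Fin (T / K) | Function.Injective f}) :=
  isProbabilityMeasure_uniformOn (Set.toFinite _) ⟨Fin.castLE hB, Fin.castLE_injective hB⟩

theorem isProbabilityMeasure_exploration (hB : m ≤ T / K) :
    IsProbabilityMeasure (exploration m T K) := by
  have := isProbabilityMeasure_uniformOn_injective hB
  unfold exploration
  infer_instance

theorem sum_exploration_real (hB : m ≤ T / K) :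
    ∑ τ : Fin K → Fin m → Fin (T / K), (exploration m T K).real {τ} = 1 := by
  have := isProbabilityMeasure_exploration hB
  rw [sum_measureReal_singleton, Finset.coe_univ, probReal_univ]

theorem uniformOn_injective_congr {B : ℕ} {f f' : Fin m → Fin B}
    (h : Function.Injective f ↔ Function.Injective f') :
    uniformOn {f : Fin m → Fin B | Function.Injective f} {f} =
      uniformOn {f : Fin m → Fin B | Function.Injective f} {f'} := by
  have hm : MeasurableSet {f : Fin m → Fin B | Function.Injective f} :=
    Set.Finite.measurableSet (Set.toFinite _)
  rw [uniformOn, cond_apply hm, cond_apply hm]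
  congr 1
  by_cases hf : Function.Injective f
  · rw [Set.inter_singleton_of_mem (show f ∈ {f | Function.Injective f} from hf),
      Set.inter_singleton_of_mem (show f' ∈ {f | Function.Injective f} from h.1 hf),
      Measure.count_singleton, Measure.count_singleton]
  · rw [Set.inter_singleton_eq_empty.2 (show f ∉ {f | Function.Injective f} from hf),
      Set.inter_singleton_eq_empty.2 (show f' ∉ {f | Function.Injective f} from
        fun h' => hf (h.2 h'))]

theorem exploration_real_eq_zero (hB : m ≤ T / K) {τ : Fin K → Fin m → Fin (T / K)}
    (hτ : ¬ ∀ k, Function.Injective (τ k)) : (exploration m T K).real {τ} = 0 := by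
  have := isProbabilityMeasure_uniformOn_injective hB
  obtain ⟨k, hk⟩ := not_forall.1 hτ
  rw [Measure.real, exploration, Measure.pi_singleton, ENNReal.toReal_prod]
  refine Finset.prod_eq_zero (Finset.mem_univ k) ?_
  have hm : MeasurableSet {f : Fin m → Fin (T / K) | Function.Injective f} :=
    Set.Finite.measurableSet (Set.toFinite _)
  rw [uniformOn, cond_apply hm,
    Set.inter_singleton_eq_empty.2 (show τ k ∉ {f | Function.Injective f} from hk)]
  simp

/-- Cyclic translation of the exploration positions of block `k`. -/
def shiftBlock [NeZero (T / K)] (k : Fin K) (c : Fin (T / K)) :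
    (Fin K → Fin m → Fin (T / K)) ≃ (Fin K → Fin m → Fin (T / K)) :=
  Equiv.piCongrRight fun k' =>
    if k' = k then Equiv.piCongrRight fun _ => Equiv.addRight c else Equiv.refl _

theorem shiftBlock_apply_self [NeZero (T / K)] (k : Fin K) (c : Fin (T / K))
    (τ : Fin K → Fin m → Fin (T / K)) (j : Fin m) : shiftBlock k c τ k j = τ k j + c := by
  simp [shiftBlock]

theorem shiftBlock_apply_of_ne [NeZero (T / K)] {k k' : Fin K} (h : k' ≠ k) (c : Fin (T / K))
    (τ : Fin K → Fin m → Fin (T / K)) : shiftBlock k c τ k' = τ k' := by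
  simp [shiftBlock, h]

/-- A cyclic translation preserves injectivity, hence the uniform law on injections. -/
theorem exploration_real_shiftBlock [NeZero (T / K)] (hB : m ≤ T / K) (k : Fin K) (c : Fin (T / K))
    (τ : Fin K → Fin m → Fin (T / K)) :
    (exploration m T K).real {shiftBlock k c τ} = (exploration m T K).real {τ} := by
  have := isProbabilityMeasure_uniformOn_injective hB
  rw [Measure.real, Measure.real, exploration, Measure.pi_singleton, Measure.pi_singleton]
  congr 1
  refine Finset.prod_congr rfl fun k' _ => uniformOn_injective_congr ?_
  rcases eq_or_ne k' k with rfl | h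
  · have : shiftBlock k' c τ k' = (fun x => x + c) ∘ τ k' :=
      funext fun j => shiftBlock_apply_self k' c τ j
    rw [this, (add_left_injective c).of_comp_iff]
  · rw [shiftBlock_apply_of_ne h]

/-- The observation at an exploration round is an unbiased estimate of the average over its block,
independently of the other blocks. -/
theorem sum_exploration_mul (hB : m ≤ T / K) (k : Fin K) (j : Fin m)
    {Φ : (Fin K → Fin m → Fin (T / K)) → ℝ}
    (hΦ : ∀ τ τ', (∀ k' ≠ k, τ k' = τ' k') → Φ τ = Φ τ') (u : Fin (T / K) → ℝ) :
    ∑ τ, (exploration m T K).real {τ} * (Φ τ * ∑ b, u b) =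
      (T / K : ℕ) * ∑ τ, (exploration m T K).real {τ} * (Φ τ * u (τ k j)) := by
  have : NeZero (T / K) := ⟨by have := j.2; omega⟩
  -- The block sum is a sum over cyclic shifts starting at the explored position; each shift is
  -- absorbed by the invariance of the law, and `Φ` does not see it.
  have h1 : ∀ τ : Fin K → Fin m → Fin (T / K),
      ∑ b, u b = ∑ c, u (τ k j + c) := fun τ => (Equiv.sum_comp (Equiv.addLeft (τ k j)) u).symm
  have h2 : ∀ c : Fin (T / K), ∑ τ, (exploration m T K).real {τ} * (Φ τ * u (τ k j + c)) =
      ∑ τ, (exploration m T K).real {τ} * (Φ τ * u (τ k j)) := by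
    intro c
    refine Eq.trans ?_ (Equiv.sum_comp (shiftBlock k c) fun τ =>
      (exploration m T K).real {τ} * (Φ τ * u (τ k j)))
    refine Finset.sum_congr rfl fun τ _ => ?_
    rw [exploration_real_shiftBlock hB, shiftBlock_apply_self,
      hΦ (shiftBlock k c τ) τ fun k' h => shiftBlock_apply_of_ne h c τ]
  calc _ = ∑ τ, ∑ c, (exploration m T K).real {τ} * (Φ τ * u (τ k j + c)) := by
        refine Finset.sum_congr rfl fun τ _ => ?_
        rw [h1 τ, Finset.mul_sum, Finset.mul_sum]
    _ = _ := by
        rw [Finset.sum_comm]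
        simp only [h2]
        simp

end Exploration

/-! ### Regret of RTop-1F -/

section Regret

variable {m n T K : ℕ}

/-- The transformed relevances in round `t`, extended by zero beyond the horizon. -/
noncomputable def transformed (g : Fin (n + 1) → ℝ) (r : Fin T → Relevance m n) (t : ℕ)
    (j : Fin m) : ℝ :=
  if h : t < T then g (r ⟨t, h⟩ j) else 0

theorem transformed_val (g : Fin (n + 1) → ℝ) (r : Fin T → Relevance m n) (t : Fin T)
    (j : Fin m) : transformed g r t j = g (r t j) := by
  simp [transformed]

theorem transformed_mem {g : Fin (n + 1) → ℝ} {G : ℝ} (hg : ∀ v, g v ∈ Set.Icc 0 G)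
    (r : Fin T → Relevance m n) (t : ℕ) (j : Fin m) : transformed g r t j ∈ Set.Icc 0 G := by
  unfold transformed
  split_ifs
  · exact hg _
  · exact ⟨le_rfl, (hg 0).1.trans (hg 0).2⟩

/-- The sum of the estimates of the first `q` blocks. -/
noncomputable def blockScore (x : ℕ → Fin m → ℝ) (τ : Fin K → Fin m → Fin (T / K)) (q : ℕ)
    (j : Fin m) : ℝ :=
  ∑ k : Fin K, if (k : ℕ) < q then x (exploreRound τ k j) j else 0

theorem blockScore_succ_sub (x : ℕ → Fin m → ℝ) (τ : Fin K → Fin m → Fin (T / K)) (k : Fin K)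
    (j : Fin m) :
    blockScore x τ (k + 1) j - blockScore x τ k j = x (exploreRound τ k j) j := by
  rw [blockScore, blockScore, ← Finset.sum_sub_distrib, Finset.sum_eq_single k]
  · simp
  · intro k' _ hk'
    have hne : (k' : ℕ) ≠ k := fun h => hk' (Fin.ext h)
    by_cases h : (k' : ℕ) < k
    · rw [if_pos h, if_pos (by omega), sub_self]
    · rw [if_neg h, if_neg (by omega), sub_self]
  · simp

theorem blockScore_congr (x : ℕ → Fin m → ℝ) {τ τ' : Fin K → Fin m → Fin (T / K)} (k : Fin K)
    (h : ∀ k' ≠ k, τ k' = τ' k') : blockScore x τ k = blockScore x τ' k := by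
  funext j
  refine Finset.sum_congr rfl fun k' _ => ?_
  split_ifs with hk'
  · have : k' ≠ k := by rintro rfl; omega
    simp only [exploreRound, h k' this]
  · rfl

theorem sum_exploring_le (τ : Fin K → Fin m → Fin (T / K)) :
    ∑ t : Fin T, ∑ kj : Fin K × Fin m,
      (if (t : ℕ) = exploreRound τ kj.1 kj.2 then (1 : ℝ) else 0) ≤ K * m := by
  rw [Finset.sum_comm]
  calc _ ≤ ∑ _kj : Fin K × Fin m, (1 : ℝ) := by
        refine Finset.sum_le_sum fun kj _ => ?_
        have hs := exploreRound_lt_horizon τ kj.1 kj.2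
        have : ∀ t : Fin T, ((t : ℕ) = exploreRound τ kj.1 kj.2) = (t = ⟨_, hs⟩) := fun t => by
          rw [Fin.ext_iff]
        simp only [this, Finset.sum_ite_eq', Finset.mem_univ, if_true, le_refl]
    _ = K * m := by simp

variable [NeZero m]

theorem feedback_exploreRound {g : Fin (n + 1) → ℝ} {M : ArgminRule m}
    {explore : Fin T → Fin m → Equiv.Perm (Fin m)} (hexp : ∀ t j, topObject (explore t j) = j)
    {ω : Randomness m T K} (hω : ∀ k, Function.Injective (ω.1 k)) (r : Fin T → Relevance m n)
    (k : Fin K) (j : Fin m) (h : exploreRound ω.1 k j < T) :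
    feedback (rtop1fAct g M explore ω) r ⟨exploreRound ω.1 k j, h⟩ =
      r ⟨exploreRound ω.1 k j, h⟩ j := by
  have hx : ∃ kj : Fin K × Fin m, exploreRound ω.1 k j = exploreRound ω.1 kj.1 kj.2 :=
    ⟨(k, j), rfl⟩
  rw [feedback_eq, played, rtop1fAct, dif_pos hx, hexp,
    ← eq_of_exploreRound_eq hω hx.choose_spec]

-- Removes the recursion through feedback: once the exploration positions are fixed, the scores
-- depend only on the relevances, not on the perturbations.
open Classical in
theorem played_rtop1fAct {g : Fin (n + 1) → ℝ} {M : ArgminRule m}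
    {explore : Fin T → Fin m → Equiv.Perm (Fin m)} (hexp : ∀ t j, topObject (explore t j) = j)
    {ω : Randomness m T K} (hω : ∀ k, Function.Injective (ω.1 k)) (r : Fin T → Relevance m n)
    (t : Fin T) :
    played (rtop1fAct g M explore ω) r t =
      if hx : ∃ kj : Fin K × Fin m, (t : ℕ) = exploreRound ω.1 kj.1 kj.2
      then explore t hx.choose.2
      else M.toFun (blockScore (transformed g r) ω.1 (t / (T / K)) + ω.2 t) := by
  rw [played, rtop1fAct]
  split_ifs with hx
  · rfl
  · congr 2
    funext j
    refine Finset.sum_congr rfl fun k _ => ?_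
    split_ifs with hk
    · have h := exploreRound_lt_horizon ω.1 k j
      rw [transformed, dif_pos h, ← feedback_exploreRound hexp hω r k j h]
    · rfl

/-- Up to the exploration rounds, the algorithm gains at least as much as the perturbed leader. -/
theorem gain_played_ge {g : Fin (n + 1) → ℝ} {G : ℝ} (hg : ∀ v, g v ∈ Set.Icc 0 G)
    {M : ArgminRule m} {explore : Fin T → Fin m → Equiv.Perm (Fin m)}
    (hexp : ∀ t j, topObject (explore t j) = j) {ω : Randomness m T K}
    (hω : ∀ k, Function.Injective (ω.1 k)) (r : Fin T → Relevance m n) :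
    ∑ t : Fin T, ∑ i, discount
        (M.toFun (blockScore (transformed g r) ω.1 (t / (T / K)) + ω.2 t) i) * g (r t i) -
        K * m * (m * G) ≤
      ∑ t, ∑ i, discount (played (rtop1fAct g M explore ω) r t i) * g (r t i) := by
  have hG : 0 ≤ m * G := mul_nonneg m.cast_nonneg ((hg 0).1.trans (hg 0).2)
  have hgain : ∀ (σ : Equiv.Perm (Fin m)) (t : Fin T),
      ∑ i, discount (σ i) * g (r t i) ∈ Set.Icc 0 (m * G) := fun σ t =>
    sum_discount_mul_mem (fun i => (hg _).1) (fun i => (hg _).2) σ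
  have h1 := mul_le_mul_of_nonneg_right (sum_exploring_le ω.1) hG
  rw [Finset.sum_mul] at h1
  have h2 : ∀ t ∈ Finset.univ, ∑ i, discount
        (M.toFun (blockScore (transformed g r) ω.1 ((t : Fin T) / (T / K)) + ω.2 t) i) * g (r t i) ≤
      ∑ i, discount (played (rtop1fAct g M explore ω) r t i) * g (r t i) +
        (∑ kj : Fin K × Fin m, (if (t : ℕ) = exploreRound ω.1 kj.1 kj.2 then (1 : ℝ) else 0)) *
          (m * G) := by
    intro t _
    have h0 : ∀ kj ∈ (Finset.univ : Finset (Fin K × Fin m)),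
        0 ≤ if (t : ℕ) = exploreRound ω.1 kj.1 kj.2 then (1 : ℝ) else 0 := fun kj _ => by
      split_ifs <;> norm_num
    by_cases hx : ∃ kj : Fin K × Fin m, (t : ℕ) = exploreRound ω.1 kj.1 kj.2
    · obtain ⟨kj, hkj⟩ := hx
      have h3 := Finset.single_le_sum h0 (Finset.mem_univ kj)
      rw [if_pos hkj] at h3
      have h4 := (hgain
        (M.toFun (blockScore (transformed g r) ω.1 ((t : Fin T) / (T / K)) + ω.2 t)) t).2
      have h5 := (hgain (played (rtop1fAct g M explore ω) r t) t).1
      nlinarith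
    · rw [played_rtop1fAct hexp hω, dif_neg hx]
      exact le_add_of_nonneg_right (mul_nonneg (Finset.sum_nonneg h0) hG)
  have h3 := Finset.sum_le_sum h2
  rw [Finset.sum_add_distrib] at h3
  linarith

/-- Fubini, with the perturbations integrated first: for fixed positions the scores are constants,
so only the marginal law of each `p_t` matters. Non-injective positions have probability zero. -/
theorem integral_gain_ge {g : Fin (n + 1) → ℝ} {G ε : ℝ} (hg : ∀ v, g v ∈ Set.Icc 0 G)
    (M : ArgminRule m) {explore : Fin T → Fin m → Equiv.Perm (Fin m)}
    (hexp : ∀ t j, topObject (explore t j) = j) (hB : m ≤ T / K) (hε : 0 < ε)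
    (r : Fin T → Relevance m n) :
    ∑ τ : Fin K → Fin m → Fin (T / K), (exploration m T K).real {τ} *
        ∑ t : Fin T, ∑ i, meanDiscount M ε (blockScore (transformed g r) τ (t / (T / K))) i *
          g (r t i) - K * m * (m * G) ≤
      ∫ ω, ∑ t, ∑ i, discount (played ((rtop1f g M explore K ε hB hε).act ω) r t i) *
        g (r t i) ∂(rtop1f g M explore K ε hB hε).μ := by
  have := isProbabilityMeasure_exploration hB
  have := isProbabilityMeasure_perturbation (m := m) hε
  set μP : Measure (Fin T → Fin m → ℝ) := Measure.pi fun _ => perturbation m ε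
  have hint : Integrable (fun ω : Randomness m T K => ∑ t, ∑ i,
      discount (played (rtop1fAct g M explore ω) r t i) * g (r t i))
      ((exploration m T K).prod μP) := integrable_finsetSum _ fun t _ =>
    integrable_played (rtop1f g M explore K ε hB hε) r t
      fun σ => ∑ i, discount (σ i) * g (r t i)
  change _ ≤ ∫ ω : Randomness m T K, ∑ t, ∑ i,
      discount (played (rtop1fAct g M explore ω) r t i) * g (r t i) ∂((exploration m T K).prod μP)
  rw [integral_prod _ hint, integral_fintype Integrable.of_finite, sub_le_iff_le_add]
  rw [← one_mul (K * m * (m * G) : ℝ), ← sum_exploration_real hB, Finset.sum_mul,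
    ← Finset.sum_add_distrib]
  refine Finset.sum_le_sum fun τ _ => ?_
  by_cases hτ : ∀ k, Function.Injective (τ k)
  swap
  · rw [exploration_real_eq_zero hB hτ]; simp
  rw [smul_eq_mul, ← mul_add]
  refine mul_le_mul_of_nonneg_left ?_ measureReal_nonneg
  have hi1 : ∀ t : Fin T, Integrable (fun p : Fin T → Fin m → ℝ => ∑ i, discount
      (M.toFun (blockScore (transformed g r) τ (t / (T / K)) + p t) i) * g (r t i)) μP := fun t =>
    M.integrable_comp (fun σ => ∑ i, discount (σ i) * g (r t i))
      ((measurable_const_add _).comp (measurable_pi_apply t))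
  have hi2 : Integrable (fun p : Fin T → Fin m → ℝ => ∑ t, ∑ i,
      discount (played (rtop1fAct g M explore (τ, p)) r t i) * g (r t i)) μP := by
    refine integrable_finsetSum _ fun t _ => ?_
    by_cases hx : ∃ kj : Fin K × Fin m, (t : ℕ) = exploreRound τ kj.1 kj.2
    · have : ∀ p, played (rtop1fAct g M explore (τ, p)) r t = explore t hx.choose.2 := fun p => by
        rw [played_rtop1fAct hexp hτ, dif_pos hx]
      simp only [this]
      exact integrable_const _
    · have : ∀ p, played (rtop1fAct g M explore (τ, p)) r t =
          M.toFun (blockScore (transformed g r) τ (t / (T / K)) + p t) := fun p => by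
        rw [played_rtop1fAct hexp hτ, dif_neg hx]
      simp only [this]
      exact hi1 t
  have h1 := integral_mono ((integrable_finsetSum Finset.univ fun t _ => hi1 t).sub
    (integrable_const (K * m * (m * G) : ℝ))) hi2
    fun p => gain_played_ge hg (ω := (τ, p)) hexp hτ r
  rw [integral_sub' (integrable_finsetSum Finset.univ fun t _ => hi1 t) (integrable_const _),
    integral_const, probReal_univ, one_smul, integral_finsetSum _ fun t _ => hi1 t] at h1
  have h2 : ∀ t : Fin T, ∫ p : Fin T → Fin m → ℝ, ∑ i, discount
      (M.toFun (blockScore (transformed g r) τ (t / (T / K)) + p t) i) * g (r t i) ∂μP =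
      ∑ i, meanDiscount M ε (blockScore (transformed g r) τ (t / (T / K))) i * g (r t i) := by
    intro t
    rw [sum_meanDiscount_mul M hε]
    have hmp := measurePreserving_eval (fun _ : Fin T => perturbation m ε) t
    rw [← hmp.map_eq, integral_map hmp.measurable.aemeasurable]
    exact ((M.measurable_comp fun σ => ∑ i, discount (σ i) * g (r t i)).comp
      (measurable_const_add _)).aestronglyMeasurable
  simp only [h2] at h1
  exact sub_le_iff_le_add.1 h1

end Regret

/-! ### Passage from block estimates to the regret bound -/

section RegretBound

variable {m n T K : ℕ}

theorem sum_range_mul_eq (f : ℕ → ℝ) (K B : ℕ) :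
    ∑ t ∈ Finset.range (K * B), f t =
      ∑ k ∈ Finset.range K, ∑ b ∈ Finset.range B, f (k * B + b) := by
  induction K with
  | zero => simp
  | succ K ih => rw [Nat.succ_mul, Finset.sum_range_add, ih, Finset.sum_range_succ]

theorem sum_sum_sum_comm {α β γ : Type*} [Fintype α] [Fintype β] [Fintype γ]
    (f : α → β → γ → ℝ) : ∑ a, ∑ b, ∑ c, f a b c = ∑ c, ∑ b, ∑ a, f a b c := by
  rw [Finset.sum_comm]
  refine (Finset.sum_congr rfl fun b _ => Finset.sum_comm).trans ?_
  rw [Finset.sum_comm]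

theorem blockScore_zero (x : ℕ → Fin m → ℝ) (τ : Fin K → Fin m → Fin (T / K)) :
    blockScore x τ 0 = 0 := by
  funext j
  simp [blockScore]

/-- Playing with weights `φ` that depend on earlier blocks only, the gain in the blocks can be
estimated from the exploration rounds. -/
theorem sum_exploration_mul_blocks (hB : m ≤ T / K) (x : ℕ → Fin m → ℝ)
    (φ : (Fin m → ℝ) → Fin m → ℝ) :
    ∑ τ : Fin K → Fin m → Fin (T / K), (exploration m T K).real {τ} *
        ∑ t ∈ Finset.range (K * (T / K)), ∑ i, φ (blockScore x τ (t / (T / K))) i * x t i =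
      (T / K : ℕ) * ∑ τ : Fin K → Fin m → Fin (T / K), (exploration m T K).real {τ} *
        ∑ k ∈ Finset.range K, ∑ i, φ (blockScore x τ k) i *
          (blockScore x τ (k + 1) i - blockScore x τ k i) := by
  have h1 : ∀ τ : Fin K → Fin m → Fin (T / K),
      ∑ t ∈ Finset.range (K * (T / K)), ∑ i, φ (blockScore x τ (t / (T / K))) i * x t i =
      ∑ k : Fin K, ∑ i, φ (blockScore x τ k) i * ∑ b : Fin (T / K), x (k * (T / K) + b) i := by
    intro τ
    rw [sum_range_mul_eq, ← Fin.sum_univ_eq_sum_range (fun k => ∑ b ∈ Finset.range (T / K),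
      ∑ i, φ (blockScore x τ ((k * (T / K) + b) / (T / K))) i * x (k * (T / K) + b) i)]
    refine Finset.sum_congr rfl fun k _ => ?_
    rw [Finset.sum_comm]
    refine Finset.sum_congr rfl fun i _ => ?_
    rw [Finset.mul_sum, ← Fin.sum_univ_eq_sum_range (fun b =>
      φ (blockScore x τ ((k * (T / K) + b) / (T / K))) i * x (k * (T / K) + b) i)]
    refine Finset.sum_congr rfl fun b _ => ?_
    have hb := b.2
    rw [mul_comm (k : ℕ), Nat.mul_add_div (by omega), Nat.div_eq_of_lt hb, add_zero]
  have h2 : ∀ τ : Fin K → Fin m → Fin (T / K),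
      ∑ k ∈ Finset.range K, ∑ i, φ (blockScore x τ k) i *
          (blockScore x τ (k + 1) i - blockScore x τ k i) =
      ∑ k : Fin K, ∑ i, φ (blockScore x τ k) i * x (exploreRound τ k i) i := by
    intro τ
    rw [← Fin.sum_univ_eq_sum_range (fun k => ∑ i, φ (blockScore x τ k) i *
          (blockScore x τ (k + 1) i - blockScore x τ k i))]
    simp only [blockScore_succ_sub]
  simp only [h1, h2, Finset.mul_sum (s := (Finset.univ : Finset (Fin K))),
    Finset.mul_sum (s := (Finset.univ : Finset (Fin m)))]
  refine (sum_sum_sum_comm _).trans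
    (Eq.trans ?_ (congrArg (((T / K : ℕ) : ℝ) * ·) (sum_sum_sum_comm _).symm))
  simp only [Finset.mul_sum (s := (Finset.univ : Finset (Fin K))),
    Finset.mul_sum (s := (Finset.univ : Finset (Fin m)))]
  refine Finset.sum_congr rfl fun i _ => Finset.sum_congr rfl fun k _ => ?_
  -- The weight used in block `k` is a function of the earlier blocks, as unbiasedness requires.
  exact sum_exploration_mul hB k i (Φ := fun τ => φ (blockScore x τ k) i)
    (fun τ τ' h => by rw [blockScore_congr x k h]) fun b => x (k * (T / K) + b) i

/-- Both the comparator's and the algorithm's block gains become `T / K` times expectations over the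
estimates, where `follow_perturbed_leader` holds for every choice of positions. The last two terms
pay for exploration and for the leftover rounds. -/
theorem regret_rtop1f_le [NeZero m] {g : Fin (n + 1) → ℝ} {G ε : ℝ}
    (hg : ∀ v, g v ∈ Set.Icc 0 G) (M : ArgminRule m)
    {explore : Fin T → Fin m → Equiv.Perm (Fin m)} (hexp : ∀ t j, topObject (explore t j) = j)
    (hK : 0 < K) (hB : m ≤ T / K) (hε : 0 < ε) {gain : Equiv.Perm (Fin m) → Relevance m n → ℝ}
    (hgain : ∀ σ r, gain σ r = ∑ i, discount (σ i) * g (r i)) (r : Fin T → Relevance m n) :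
    regret (rtop1f g M explore K ε hB hε) gain r ≤
      (T / K : ℕ) * (m / ε + ε * K * (m * G) ^ 2) + K * m * (m * G) + K * (m * G) := by
  have hint := integral_gain_ge hg M hexp hB hε r
  set x := transformed g r with hx
  have hx0 : ∀ t i, 0 ≤ x t i := fun t i => (transformed_mem hg r t i).1
  have hxG : ∀ t i, x t i ≤ G := fun t i => (transformed_mem hg r t i).2
  have hG : 0 ≤ m * G := mul_nonneg m.cast_nonneg ((hg 0).1.trans (hg 0).2)
  rw [regret, sub_le_iff_le_add]
  refine Finset.sup'_le _ _ fun σ _ => ?_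
  simp only [hgain]
  simp only [← transformed_val g r, ← hx] at hint ⊢
  have hT : T = K * (T / K) + T % K := (Nat.div_add_mod T K).symm
  have h1 : ∑ t : Fin T, ∑ i, discount (σ i) * x t i ≤
      ∑ t ∈ Finset.range (K * (T / K)), ∑ i, discount (σ i) * x t i + K * (m * G) := by
    rw [Fin.sum_univ_eq_sum_range (fun t => ∑ i, discount (σ i) * x t i)]
    nth_rewrite 1 [hT]
    rw [Finset.sum_range_add]
    refine add_le_add le_rfl ?_
    calc _ ≤ ∑ _t ∈ Finset.range (T % K), m * G := Finset.sum_le_sum fun t _ =>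
          (sum_discount_mul_mem (hx0 _) (hxG _) σ).2
      _ = (T % K : ℕ) * (m * G) := by simp
      _ ≤ K * (m * G) := by
        refine mul_le_mul_of_nonneg_right ?_ hG
        exact_mod_cast (Nat.mod_lt T hK).le
  have hw0 : ∀ τ : Fin K → Fin m → Fin (T / K), 0 ≤ (exploration m T K).real {τ} := fun τ =>
    measureReal_nonneg
  have h2 : ∑ τ : Fin K → Fin m → Fin (T / K), (exploration m T K).real {τ} *
        ∑ t ∈ Finset.range (K * (T / K)),
          ∑ i, meanDiscount M ε (blockScore x τ (t / (T / K))) i * x t i ≤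
      ∑ τ : Fin K → Fin m → Fin (T / K), (exploration m T K).real {τ} *
        ∑ t : Fin T, ∑ i, meanDiscount M ε (blockScore x τ (t / (T / K))) i * x t i := by
    refine Finset.sum_le_sum fun τ _ => mul_le_mul_of_nonneg_left ?_ (hw0 τ)
    rw [Fin.sum_univ_eq_sum_range
      (fun t => ∑ i, meanDiscount M ε (blockScore x τ (t / (T / K))) i * x t i)]
    exact Finset.sum_le_sum_of_subset_of_nonneg
      (Finset.range_subset_range.2 (Nat.mul_div_le T K)) fun t _ _ =>
        Finset.sum_nonneg fun i _ => mul_nonneg (meanDiscount_nonneg _ _ _ _) (hx0 _ _)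
  rw [sum_exploration_mul_blocks hB] at h2
  have h3 : ∀ τ ∈ (Finset.univ : Finset (Fin K → Fin m → Fin (T / K))),
      (exploration m T K).real {τ} * (∑ i, discount (σ i) * blockScore x τ K i -
        (m / ε + ε * K * (m * G) ^ 2)) ≤ (exploration m T K).real {τ} *
        ∑ k ∈ Finset.range K, ∑ i, meanDiscount M ε (blockScore x τ k) i *
          (blockScore x τ (k + 1) i - blockScore x τ k i) := by
    intro τ _
    refine mul_le_mul_of_nonneg_left ?_ (hw0 τ)
    rw [sub_le_iff_le_add]
    have hsub : ∀ (k : ℕ) (hk : k < K) (i : Fin m),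
        blockScore x τ (k + 1) i - blockScore x τ k i = x (exploreRound τ ⟨k, hk⟩ i) i :=
      fun k hk i => blockScore_succ_sub x τ ⟨k, hk⟩ i
    refine follow_perturbed_leader M hε (blockScore_zero x τ) (fun k hk i => ?_)
      (fun k hk i => ?_) σ
    · rw [hsub k hk]; exact hx0 _ _
    · rw [hsub k hk]; exact hxG _ _
  have h4 := Finset.sum_le_sum h3
  have hR : ∀ (P : (Fin K → Fin m → Fin (T / K)) → ℝ) (R : ℝ),
      ∑ τ, (exploration m T K).real {τ} * (P τ - R) =
        ∑ τ, (exploration m T K).real {τ} * P τ - R := fun P R => by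
    simp only [mul_sub, Finset.sum_sub_distrib, ← Finset.sum_mul, sum_exploration_real hB, one_mul]
  rw [hR] at h4
  -- Unbiasedness with constant weights; the estimates telescope to the final score.
  have h5 : ∑ t ∈ Finset.range (K * (T / K)), ∑ i, discount (σ i) * x t i =
      (T / K : ℕ) * ∑ τ : Fin K → Fin m → Fin (T / K), (exploration m T K).real {τ} *
        ∑ i, discount (σ i) * blockScore x τ K i := by
    have := sum_exploration_mul_blocks hB x fun _ i => discount (σ i)
    rw [← Finset.sum_mul, sum_exploration_real hB, one_mul] at this
    rw [this]
    congr 1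
    refine Finset.sum_congr rfl fun τ _ => ?_
    rw [Finset.sum_comm]
    congr 1
    refine Finset.sum_congr rfl fun i _ => ?_
    rw [← Finset.mul_sum, Finset.sum_range_sub (fun k => blockScore x τ k i), blockScore_zero,
      Pi.zero_apply, sub_zero]
  have h6 := mul_le_mul_of_nonneg_left h4 (Nat.cast_nonneg (α := ℝ) (T / K))
  rw [mul_sub] at h6
  linarith

end RegretBound

/-! ### Tuning of the parameters -/

section Tuning

variable {m T : ℕ}

/-- Division by zero yields `0`, so zero blocks would contradict `m ≥ 1`. -/
theorem numBlocks_pos (hm : 1 ≤ m) (hB : m ≤ T / numBlocks m T) : 0 < numBlocks m T := by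
  rcases Nat.eq_zero_or_pos (numBlocks m T) with h | h
  · rw [h, Nat.div_zero] at hB
    omega
  · exact h

theorem tuning_pos {G : ℝ} (hG : 0 < G) (hm : 1 ≤ m) (hB : m ≤ T / numBlocks m T) :
    0 < √(1 / (G ^ 2 * m * numBlocks m T)) := by
  have h1 : (0 : ℝ) < m := by exact_mod_cast hm
  have h2 : (0 : ℝ) < numBlocks m T := by exact_mod_cast numBlocks_pos hm hB
  positivity

/-- Cube roots of `m` and `T` express the number of blocks. -/
theorem exists_cbrt (hm : 1 ≤ m) (T : ℕ) : ∃ a b : ℝ, 1 ≤ a ∧ 0 ≤ b ∧ a ^ 3 = m ∧ b ^ 3 = T ∧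
    (m : ℝ) ^ (5 / 3 : ℝ) = a ^ 5 ∧ (T : ℝ) ^ (2 / 3 : ℝ) = b ^ 2 ∧
    numBlocks m T = ⌊b ^ 2 / a⌋₊ := by
  have hm0 : (0 : ℝ) ≤ m := m.cast_nonneg
  have hT0 : (0 : ℝ) ≤ T := T.cast_nonneg
  have hpow : ∀ (x : ℝ) (k : ℕ), 0 ≤ x → (x ^ (1 / 3 : ℝ)) ^ k = x ^ ((k : ℝ) / 3) := by
    intro x k hx
    rw [← Real.rpow_natCast, ← Real.rpow_mul hx]
    congr 1
    ring
  refine ⟨(m : ℝ) ^ (1 / 3 : ℝ), (T : ℝ) ^ (1 / 3 : ℝ),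
    Real.one_le_rpow (by exact_mod_cast hm) (by norm_num), by positivity, ?_, ?_, ?_, ?_, ?_⟩
  · rw [hpow _ _ hm0]; norm_num
  · rw [hpow _ _ hT0]; norm_num
  · rw [hpow _ _ hm0]; norm_num
  · rw [hpow _ _ hT0]; norm_num
  · rw [numBlocks, hpow _ _ hT0, Real.rpow_neg hm0, mul_comm, ← div_eq_mul_inv]
    norm_num

/-- With `s = √(m * K)` and `ε = 1 / (G * s)` the two perturbation terms both equal `m * G * s`.
They contribute `4` to the constant, exploration and leftover rounds `1` each. -/
theorem tuned_bound_le {G : ℝ} (hG : 0 < G) (hm : 1 ≤ m) (hB : m ≤ T / numBlocks m T) {ε : ℝ}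
    (hε : ε = √(1 / (G ^ 2 * m * numBlocks m T))) :
    (T / numBlocks m T : ℕ) * (m / ε + ε * numBlocks m T * (m * G) ^ 2) +
        numBlocks m T * m * (m * G) + numBlocks m T * (m * G) ≤
      6 * (G * (m : ℝ) ^ (5 / 3 : ℝ) * (T : ℝ) ^ (2 / 3 : ℝ)) := by
  have hK := numBlocks_pos hm hB
  obtain ⟨a, b, ha, hb, hma, hTb, h5, h2, hKab⟩ := exists_cbrt hm T
  rw [h5, h2]
  set K := numBlocks m T
  have hK' : (1 : ℝ) ≤ K := by exact_mod_cast hK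
  have hm' : (1 : ℝ) ≤ m := by exact_mod_cast hm
  have hKle : K * a ≤ b ^ 2 := by
    rw [← le_div_iff₀ (by linarith), hKab]
    exact Nat.floor_le (by positivity)
  -- Since `K ≥ 1`, rounding down loses at most a factor `2`.
  have hKge : b ^ 2 ≤ 2 * K * a := by
    have h := Nat.lt_floor_add_one (b ^ 2 / a)
    rw [← hKab, div_lt_iff₀ (by linarith)] at h
    nlinarith
  have hb0 : 0 < b := by
    rcases hb.eq_or_lt with h | h
    · rw [← h] at hKle; nlinarith
    · exact h
  set s : ℝ := √(m * K) with hs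
  have hs0 : 0 < s := Real.sqrt_pos.2 (by positivity)
  have hs2 : s ^ 2 = m * K := Real.sq_sqrt (by positivity)
  have hε' : ε = 1 / (G * s) := by
    rw [hε, show 1 / (G ^ 2 * m * K) = (1 / (G * s)) ^ 2 by
      rw [div_pow, mul_pow, hs2]; ring, Real.sqrt_sq (by positivity)]
  have hsum : m / ε + ε * K * (m * G) ^ 2 = 2 * m * G * s := by
    rw [hε', div_div_eq_mul_div, div_one]
    have : 1 / (G * s) * K * (m * G) ^ 2 = m * G * (m * K) / s := by
      field_simp
    rw [this, ← hs2]
    field_simp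
    ring
  have hBK : ((T / K : ℕ) : ℝ) * K ≤ b ^ 3 := by
    rw [hTb]
    exact_mod_cast Nat.div_mul_le_self T K
  have hsb : s * b ≤ 2 * a ^ 2 * K := by
    rw [← pow_le_pow_iff_left₀ (by positivity) (by positivity) two_ne_zero]
    calc (s * b) ^ 2 = a ^ 3 * K * b ^ 2 := by rw [mul_pow, hs2, hma]
      _ ≤ a ^ 3 * K * (2 * K * a) := by gcongr
      _ ≤ (2 * a ^ 2 * K) ^ 2 := by
        have : 0 ≤ a ^ 4 * (K : ℝ) ^ 2 := by positivity
        nlinarith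
  have hBs : ((T / K : ℕ) : ℝ) * s ≤ 2 * a ^ 2 * b ^ 2 := by
    refine le_of_mul_le_mul_right ?_ hb0
    calc ((T / K : ℕ) : ℝ) * s * b = (T / K : ℕ) * (s * b) := by ring
      _ ≤ (T / K : ℕ) * (2 * a ^ 2 * K) := by gcongr
      _ = 2 * a ^ 2 * ((T / K : ℕ) * K) := by ring
      _ ≤ 2 * a ^ 2 * b ^ 3 := by gcongr
      _ = 2 * a ^ 2 * b ^ 2 * b := by ring
  have hfirst : ((T / K : ℕ) : ℝ) * (2 * m * G * s) ≤ 4 * (G * a ^ 5 * b ^ 2) := by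
    calc ((T / K : ℕ) : ℝ) * (2 * m * G * s) = 2 * m * G * ((T / K : ℕ) * s) := by ring
      _ ≤ 2 * m * G * (2 * a ^ 2 * b ^ 2) := by gcongr
      _ = 4 * (G * a ^ 5 * b ^ 2) := by rw [← hma]; ring
  have hsecond : K * m * (m * G) ≤ G * a ^ 5 * b ^ 2 := by
    calc K * m * (m * G) = G * a ^ 5 * (K * a) := by rw [← hma]; ring
      _ ≤ G * a ^ 5 * b ^ 2 := by gcongr
  have hthird : K * (m * G) ≤ K * m * (m * G) := by
    have : (K : ℝ) ≤ K * m := le_mul_of_one_le_right (by positivity) hm'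
    gcongr
  rw [hsum]
  linarith

/-- In cube roots, `m ^ 2 ≤ T` reads `a ^ 2 ≤ b`, so `m * K = a ^ 2 * (K * a) ≤ b * b ^ 2 = T`. -/
theorem le_div_numBlocks (hm : 1 ≤ m) (hT : m ^ 2 ≤ T) : m ≤ T / numBlocks m T := by
  obtain ⟨a, b, ha, hb, hma, hTb, -, -, hKab⟩ := exists_cbrt hm T
  have ha0 : 0 < a := by linarith
  have hab : a ^ 2 ≤ b := by
    rw [← pow_le_pow_iff_left₀ (by positivity) hb (show (3 : ℕ) ≠ 0 by norm_num), hTb,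
      show (a ^ 2) ^ 3 = (a ^ 3) ^ 2 by ring, hma]
    exact_mod_cast hT
  have hK : 0 < numBlocks m T := by
    rw [hKab, Nat.floor_pos, le_div_iff₀ ha0]
    nlinarith
  have hKle : numBlocks m T * a ≤ b ^ 2 := by
    rw [← le_div_iff₀ ha0, hKab]
    exact Nat.floor_le (by positivity)
  rw [Nat.le_div_iff_mul_le hK]
  have : (m : ℝ) * numBlocks m T ≤ T := by
    calc (m : ℝ) * numBlocks m T = a ^ 2 * (numBlocks m T * a) := by rw [← hma]; ring
      _ ≤ b * b ^ 2 := by gcongr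
      _ = T := by rw [← hTb]; ring
  exact_mod_cast this

end Tuning

end TopOne

theorem mainTheorem4 :
    -- Regret of RTop-1F for DCG with relevance levels `{0, …, n}`.
    (∃ C : ℝ, 0 < C ∧ ∀ (m n T : ℕ) [NeZero m], 1 ≤ n →
      ∀ hB : m ≤ T / TopOne.numBlocks m T,
      ∃ hε : 0 < √(1 / (((2 : ℝ) ^ n - 1) ^ 2 * m * TopOne.numBlocks m T)),
      ∀ (M : TopOne.ArgminRule m) (explore : Fin T → Fin m → Equiv.Perm (Fin m)),
      (∀ t j, TopOne.topObject (explore t j) = j) →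
      ∀ r : Fin T → TopOne.Relevance m n,
        TopOne.regret
            (TopOne.rtop1f (fun v : Fin (n + 1) => (2 : ℝ) ^ (v : ℕ) - 1) M explore
              (TopOne.numBlocks m T)
              (√(1 / (((2 : ℝ) ^ n - 1) ^ 2 * m * TopOne.numBlocks m T))) hB hε)
            TopOne.dcg r
          ≤ C * (((2 : ℝ) ^ n - 1) * (m : ℝ) ^ (5 / 3 : ℝ) * (T : ℝ) ^ (2 / 3 : ℝ))) ∧
    -- Binary relevance: the algorithm runs on the untransformed relevances.
    (∃ C : ℝ, 0 < C ∧ ∀ (m T : ℕ) [NeZero m],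
      ∀ hB : m ≤ T / TopOne.numBlocks m T,
      ∃ hε : 0 < √(1 / ((m : ℝ) * TopOne.numBlocks m T)),
      ∀ (M : TopOne.ArgminRule m) (explore : Fin T → Fin m → Equiv.Perm (Fin m)),
      (∀ t j, TopOne.topObject (explore t j) = j) →
      ∀ r : Fin T → TopOne.Relevance m 1,
        TopOne.regret
            (TopOne.rtop1f (fun v : Fin (1 + 1) => ((v : ℕ) : ℝ)) M explore
              (TopOne.numBlocks m T)
              (√(1 / ((m : ℝ) * TopOne.numBlocks m T))) hB hε)
            TopOne.binaryDCG r
          ≤ C * ((m : ℝ) ^ (5 / 3 : ℝ) * (T : ℝ) ^ (2 / 3 : ℝ))) ∧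
    -- The blocks are long enough for the algorithm to run as soon as `T ≥ m ^ 2`.
    (∀ m T : ℕ, 1 ≤ m → m ^ 2 ≤ T → m ≤ T / TopOne.numBlocks m T) ∧
    -- Local observability fails.
    (∀ (m n : ℕ) [NeZero m], 3 ≤ m → 1 ≤ n → ¬ TopOne.LocallyObservable m n) ∧
    -- Lower bound for every learner.
    (∃ c : ℝ, 0 < c ∧ ∀ (m n T : ℕ) [NeZero m], 3 ≤ m → 1 ≤ n →
      ∀ L : TopOne.Learner m n T, ∃ r : Fin T → TopOne.Relevance m n,
        c * (T : ℝ) ^ (2 / 3 : ℝ) ≤ TopOne.regret L TopOne.dcg r) := by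
  refine ⟨⟨6, by norm_num, ?_⟩, ⟨6, by norm_num, ?_⟩, fun m T => TopOne.le_div_numBlocks,
    fun m n _ => TopOne.not_locallyObservable,
    ⟨1 / 64, by norm_num, fun m n T _ hm hn L => TopOne.exists_regret_ge hm hn L⟩⟩
  · intro m n T _ hn hB
    have hm : 1 ≤ m := NeZero.one_le
    have hG := TopOne.two_pow_sub_one_pos hn
    refine ⟨TopOne.tuning_pos hG hm hB, fun M explore hexp r => ?_⟩
    refine (TopOne.regret_rtop1f_le (G := 2 ^ n - 1) (fun v => ⟨?_, ?_⟩) M hexp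
      (TopOne.numBlocks_pos hm hB) hB _ TopOne.dcg_eq r).trans (TopOne.tuned_bound_le hG hm hB rfl)
    · exact sub_nonneg.2 (one_le_pow₀ (by norm_num))
    · exact sub_le_sub_right (pow_le_pow_right₀ (by norm_num) (Nat.le_of_lt_succ v.2)) _
  · intro m T _ hB
    have hm : 1 ≤ m := NeZero.one_le
    have hpos := TopOne.tuning_pos one_pos hm hB
    rw [one_pow, one_mul] at hpos
    refine ⟨hpos, fun M explore hexp r => ?_⟩
    have h := TopOne.tuned_bound_le (G := 1) one_pos hm hB
      (ε := √(1 / ((m : ℝ) * TopOne.numBlocks m T))) (by rw [one_pow, one_mul])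
    rw [one_mul] at h
    refine (TopOne.regret_rtop1f_le (G := 1) (fun v => ⟨Nat.cast_nonneg _, ?_⟩) M hexp
      (TopOne.numBlocks_pos hm hB) hB _ TopOne.binaryDCG_eq r).trans h
    exact_mod_cast Nat.le_of_lt_succ v.2
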